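/- Let $n\ge 2$ be an integer and $\alpha\in(0,1)$. For $N\ge1$ and $\phi\in C_c^\infty(\mathbb R^N;\mathbb R^N)$ put $$\operatorname{div}^\alpha_{\mathbb R^N}\phi(x)=\mu_{N,\alpha}\int_{\mathbb R^N}\frac{(\phi(y)-\phi(x))\cdot(y-x)}{|y-x|^{N+\alpha+1}}\,dy,\qquad \mu_{N,\alpha}=2^\alpha\pi^{-N/2}\,\frac{\Gamma\left(\frac{N+\alpha+1}{2}\right)}{\Gamma\left(\frac{1-\alpha}{2}\right)}.$$ Write $f\in BV^{\alpha,\infty}_{\mathrm{loc}}(\mathbb R^N)$ if $f\in L^\infty(\mathbb R^N)$ is real-valued and, for every relatively compact open set $A\subset\mathbb R^N$, $$\sup\left\{\int_{\mathbb R^N}f\,\operatorname{div}^\alpha_{\mathbb R^N}\phi\,dx:\ \phi\in C_c^\infty(\mathbb R^N;\mathbb R^N),\ \|\phi\|_{L^\infty}\le1,\ \operatorname{supp}\phi\subset A\right\}<+\infty .$$ A fractional $\alpha$-variation measure of $f$ is an $\mathbb R^N$-valued Radon measure $D^\alpha_{\mathbb R^N}f=((D^\alpha_{\mathbb R^N})_1f,\dots,(D^\alpha_{\mathbb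 R^N})_Nf)\in\mathscr M_{\mathrm{loc}}(\mathbb R^N;\mathbb R^N)$ (finite on bounded Borel sets) such that $\int_{\mathbb R^N}f\,\operatorname{div}^\alpha_{\mathbb R^N}\phi\,dx=-\int_{\mathbb R^N}\phi\cdot dD^\alpha_{\mathbb R^N}f$ for all $\phi\in C_c^\infty(\mathbb R^N;\mathbb R^N)$. **Proposition (Splitting).** Let $f\in BV^{\alpha,\infty}_{\mathrm{loc}}(\mathbb R^n)$ and suppose that its distributional partial derivative $D_1f$ vanishes, that is, $\int_{\mathbb R^n}f\,\partial_1\varphi\,dx=0$ for all $\varphi\in C_c^\infty(\mathbb R^n)$. Then there exists $g\in BV^{\alpha,\infty}_{\mathrm{loc}}(\mathbb R^{n-1})$ such that $f((t,x))=g(x)$ for a.e. $t\in\mathbb R$ and a.e. $x\in\mathbb R^{n-1}$. Moreover, the fractional $\alpha$-variation measures $D^\alpha_{\mathbb R^n}f$ and $D^\alpha_{\mathbb R^{n-1}}g$ exist, and $$(D^\alpha_{\mathbb R^n})_i f=\mathscr L^1\otimes(D^\alpha_{\mathbb R^{n-1}})_i\,g\quad\text{in }\mathscr M_{\mathrm{loc}}(\mathbb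 R^n)\quad\text{for all } i=2,\dots,n,$$ where points of $\mathbb R^n=\mathbb R\times\mathbb R^{n-1}$ are written $(t,x)$ with $x=(x_2,\dots,x_n)$, the components of $D^\alpha_{\mathbb R^{n-1}}g$ are indexed by $i=2,\dots,n$ accordingly, and $\mathscr L^1$ is the Lebesgue measure on $\mathbb R$. -/

import Mathlib

open MeasureTheory Set
open scoped ContDiff

noncomputable section

namespace FracBV

/-- `ℝⁿ` with its Euclidean norm. -/
abbrev Rn (n : ℕ) : Type := EuclideanSpace ℝ (Fin n)

/-- The renormalization constant
`μ_{n,α} = 2^α π^{-n/2} Γ((n+α+1)/2) / Γ((1-α)/2)`. -/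
def muConst (n : ℕ) (α : ℝ) : ℝ :=
  (2 : ℝ) ^ α * Real.pi ^ (-(n : ℝ) / 2) *
    (Real.Gamma (((n : ℝ) + α + 1) / 2) / Real.Gamma ((1 - α) / 2))

/-- The fractional `α`-divergence of a vector field on `ℝⁿ`. For a compactly supported Lipschitz
field and `0 < α < 1` the integral converges absolutely. -/
def fracDiv {n : ℕ} (α : ℝ) (φ : Rn n → Rn n) (x : Rn n) : ℝ :=
  muConst n α * ∫ y, inner ℝ (φ y - φ x) (y - x) / ‖y - x‖ ^ ((n : ℝ) + α + 1)

/-- `φ ∈ C_c^∞(ℝⁿ; F)`. -/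
def IsTest {n : ℕ} {F : Type*} [NormedAddCommGroup F] [NormedSpace ℝ F] (φ : Rn n → F) : Prop :=
  ContDiff ℝ ∞ φ ∧ HasCompactSupport φ

/-- `f ∈ BV^{α,∞}_loc(ℝⁿ)`: `f ∈ L^∞(ℝⁿ)`, and for every relatively compact open set `A` the
supremum of `∫ f div^α φ` over the test fields `φ` with `‖φ‖_∞ ≤ 1` and support in `A` is finite. -/
def IsBVLoc {n : ℕ} (α : ℝ) (f : Rn n → ℝ) : Prop :=
  MemLp f ⊤ volume ∧
    ∀ A : Set (Rn n), IsOpen A → IsCompact (closure A) →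
      BddAbove {r : ℝ | ∃ φ : Rn n → Rn n, IsTest φ ∧ (∀ x, ‖φ x‖ ≤ 1) ∧ tsupport φ ⊆ A ∧
        r = ∫ x, f x * fracDiv α φ x}

/-- A real-valued (signed) Radon measure on `ℝⁿ`, finite on compact sets but possibly of infinite
total variation, given by its Jordan decomposition: the positive and the negative part are mutually
singular Borel measures, each finite on compact sets. The associated set function on bounded Borel
sets is `B ↦ pos B - neg B`; by uniqueness of the Jordan decomposition, two signed Radon measures
coincide if and only if they are equal as elements of this structure. -/
@[ext]
structure SignedRadon (n : ℕ) where
  pos : Measure (Rn n)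
  neg : Measure (Rn n)
  finite_pos : IsFiniteMeasureOnCompacts pos
  finite_neg : IsFiniteMeasureOnCompacts neg
  singular : pos ⟂ₘ neg

/-- Integral of a (compactly supported continuous) function against a signed Radon measure. -/
def SignedRadon.integral {n : ℕ} (ν : SignedRadon n) (u : Rn n → ℝ) : ℝ :=
  (∫ x, u x ∂ν.pos) - ∫ x, u x ∂ν.neg

/-- The vector-valued Radon measure `D = (D_1, …, D_n) ∈ M_loc(ℝⁿ; ℝⁿ)` is the fractional
`α`-variation measure `D^α f`, i.e. `∫ f div^α φ dx = - ∫ φ · dD` for all test fields `φ`. -/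
def IsFracVariation {n : ℕ} (α : ℝ) (f : Rn n → ℝ) (D : Fin n → SignedRadon n) : Prop :=
  ∀ φ : Rn n → Rn n, IsTest φ →
    ∫ x, f x * fracDiv α φ x = - ∑ i, (D i).integral (fun x => φ x i)

/-- The distributional partial derivative `D_i f` vanishes. -/
def WeakPartialZero {n : ℕ} (i : Fin n) (f : Rn n → ℝ) : Prop :=
  ∀ φ : Rn n → ℝ, IsTest φ →
    ∫ x, f x * fderiv ℝ φ x (EuclideanSpace.single i 1) = 0

/-- The identification `ℝ × ℝᵐ ≃ ℝ^{m+1}`, `(t, x) ↦ (t, x_1, …, x_m)`. -/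
def consHomeo (m : ℕ) : ℝ × Rn m ≃ₜ Rn (m + 1) where
  toFun p := WithLp.toLp 2 (Fin.cons p.1 (fun i => p.2 i))
  invFun y := (y 0, WithLp.toLp 2 (fun i => y i.succ))
  left_inv p := by simp
  right_inv y := by
    ext i
    refine Fin.cases ?_ (fun j => ?_) i <;> simp
  continuous_toFun := by
    refine (PiLp.continuous_toLp 2 _).comp (continuous_pi fun i => ?_)
    refine Fin.cases ?_ (fun j => ?_) i
    · simpa using continuous_fst
    · simp only [Fin.cons_succ]
      fun_prop
  continuous_invFun := by fun_prop

/-- For positive measures: the product measure `L^1 ⊗ ν`, regarded as a measure on `ℝ^{m+1}`. -/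
def lebProd {m : ℕ} (ν : Measure (Rn m)) : Measure (Rn (m + 1)) :=
  ((volume : Measure ℝ).prod ν).map (consHomeo m)

theorem lebProd_finite {m : ℕ} (ν : Measure (Rn m)) [IsFiniteMeasureOnCompacts ν] :
    IsFiniteMeasureOnCompacts (lebProd ν) :=
  Measure.IsFiniteMeasureOnCompacts.map _ (consHomeo m)

theorem lebProd_null {m : ℕ} (ν : Measure (Rn m)) [IsFiniteMeasureOnCompacts ν]
    {s : Set (Rn m)} (hs : ν s = 0) :
    lebProd ν (consHomeo m '' (univ ×ˢ s)) = 0 := by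
  unfold lebProd
  rw [(consHomeo m).measurableEmbedding.map_apply,
    preimage_image_eq _ (consHomeo m).injective, Measure.prod_prod, hs, mul_zero]

theorem lebProd_singular {m : ℕ} (μ ν : Measure (Rn m)) [IsFiniteMeasureOnCompacts μ]
    [IsFiniteMeasureOnCompacts ν] (h : μ ⟂ₘ ν) : lebProd μ ⟂ₘ lebProd ν := by
  refine Measure.MutuallySingular.mk (lebProd_null μ h.measure_nullSet)
    (lebProd_null ν h.measure_compl_nullSet) ?_
  rw [← image_union, ← prod_union, union_compl_self, univ_prod_univ, image_univ,
    (consHomeo m).surjective.range_eq]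

/-- The product `L^1 ⊗ ν` of the Lebesgue measure on `ℝ` with a signed Radon measure `ν` on `ℝᵐ`,
as a signed Radon measure on `ℝ^{m+1}`; its parts are the products of `L^1` with those of `ν`. -/
def SignedRadon.lebProd {m : ℕ} (ν : SignedRadon m) : SignedRadon (m + 1) where
  pos := FracBV.lebProd ν.pos
  neg := FracBV.lebProd ν.neg
  finite_pos := haveI := ν.finite_pos; lebProd_finite ν.pos
  finite_neg := haveI := ν.finite_neg; lebProd_finite ν.neg
  singular := haveI := ν.finite_pos; haveI := ν.finite_neg; lebProd_singular _ _ ν.singular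

end FracBV

end

/-! The heart of the matter is one identity (`integral_mul_fracDiv_eq`): if `f(t,x) = g(x)`, then
pairing `f` with the divergence of `Φ` on `ℝ^{m+1}` equals pairing `g` with the divergence of `ψ` on
`ℝᵐ`, where `ψ` is the tail of `∫ Φ(t,·) dt`. To see it, write the divergence as an integral over
increments `z = (s,y)` and integrate over `t` first. Translation invariance in `t` removes `s` from
the increment of `Φ`, leaving `V(y) · (s,y) / |(s,y)|^{m+α+2}`. Now integrate over `s`: the first
component is odd and vanishes, while the others carry `∫ (s² + |y|²)^{-(m+α+2)/2} ds`, a Gamma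
quotient times `|y|^{-(m+α+1)}`. This quotient is exactly `μ_{m,α} / μ_{m+1,α}`
(`muConst_succ_mul`). Fubini is legitimate because the kernel is jointly integrable
(`integrable_uncurry_fracKernel`).

The function `g` exists because a bounded `f` with vanishing first derivative is translation
invariant in `t`, first against test functions and then almost everywhere; a generic slice of `f`
serves as `g`. Testing the identity with `Φ = η(t) (0, φ(x))` bounds the variation of `g` by that of
`f`.

Variation measures exist by Riesz: each component of the pairing is a functional on test functions,
locally bounded in the uniform norm. It extends to `C_c`, splits into positive functionals, and the
resulting difference of measures is put in Jordan form. Testing the identity with `Φ = u e_{i+1}`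
shows that `D_{i+1} f` and `L¹ ⊗ D_i g` have the same integrals of test functions, and such
integrals determine a signed Radon measure (`SignedRadon.ext_of_integral_eq`). -/

namespace FracBV

open Filter Topology
open scoped NNReal ENNReal CompactlySupported

/-! ### Riesz representation of order-bounded functionals -/

section Riesz

variable {X : Type*} [TopologicalSpace X]

/-- The positive part of a linear functional on `C_c(X, ℝ)` that is bounded on order intervals. -/
theorem exists_nnreal_linear_ge (Λ : C_c(X, ℝ) →ₗ[ℝ] ℝ)
    (hb : ∀ v : C_c(X, ℝ≥0), BddAbove {r | ∃ w ≤ v, Λ w.toReal = r}) :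
    ∃ P : C_c(X, ℝ≥0) →ₗ[ℝ≥0] ℝ≥0, ∀ v, Λ v.toReal ≤ P v := by
  have hzero : Λ (0 : C_c(X, ℝ≥0)).toReal = 0 := by
    have : (0 : C_c(X, ℝ≥0)).toReal = 0 := by ext; simp
    rw [this, map_zero]
  have hne : ∀ v : C_c(X, ℝ≥0), {r | ∃ w ≤ v, Λ w.toReal = r}.Nonempty := fun v =>
    ⟨0, 0, fun x => by simp, hzero⟩
  -- The Riesz–Kantorovich formula for the positive part of `Λ`; `w = 0` shows that it is
  -- nonnegative.
  set p : C_c(X, ℝ≥0) → ℝ := fun v => sSup {r | ∃ w ≤ v, Λ w.toReal = r} with hp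
  have hle : ∀ v w : C_c(X, ℝ≥0), w ≤ v → Λ w.toReal ≤ p v := fun v w h =>
    le_csSup (hb v) ⟨w, h, rfl⟩
  have hge : ∀ (v : C_c(X, ℝ≥0)) (c : ℝ), (∀ w ≤ v, Λ w.toReal ≤ c) → p v ≤ c := fun v c h =>
    csSup_le (hne v) (by rintro _ ⟨w, hw, rfl⟩; exact h w hw)
  have hnonneg : ∀ v, 0 ≤ p v := fun v => by
    have := hle v 0 (fun x => by simp)
    rwa [hzero] at this
  have hadd : ∀ v w, p (v + w) = p v + p w := by
    intro v w
    apply le_antisymm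
    · refine hge _ _ fun a ha => ?_
      -- Riesz decomposition: `a ≤ v + w` splits as `a = a ⊓ v + b`, and pointwise `b ≤ w`.
      obtain ⟨b, hb'⟩ := CompactlySupportedContinuousMap.exists_add_of_le
        (f₁ := a ⊓ v) (f₂ := a) (fun x => inf_le_left)
      have hbw : b ≤ w := fun x => by
        have h1 : (a ⊓ v) x + b x = a x :=
          DFunLike.congr_fun hb' x
        have h2 : a x ≤ v x + w x := ha x
        rw [CompactlySupportedContinuousMap.inf_apply] at h1
        rcases le_total (a x) (v x) with h | h
        · rw [inf_eq_left.2 h] at h1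
          have : b x = 0 := by simpa using h1
          show b x ≤ w x
          rw [this]; exact zero_le
        · rw [inf_eq_right.2 h] at h1
          rw [← h1] at h2
          exact le_of_add_le_add_left h2
      rw [← hb', CompactlySupportedContinuousMap.toReal_add, map_add]
      exact add_le_add (hle _ _ (fun x => inf_le_right)) (hle _ _ hbw)
    · rw [← le_sub_iff_add_le]
      refine hge _ _ fun a ha => ?_
      rw [le_sub_comm]
      refine hge _ _ fun b hb' => ?_
      rw [le_sub_iff_add_le', ← map_add, ← CompactlySupportedContinuousMap.toReal_add]
      exact hle _ _ (add_le_add ha hb')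
  -- One inequality is enough: applied to `r⁻¹` and `r • v` it gives the reverse one.
  have hsm : ∀ (r : ℝ≥0) v, r ≠ 0 → p (r • v) ≤ r * p v := by
    intro r v hr
    refine hge _ _ fun a ha => ?_
    have h1 : r⁻¹ • a ≤ v := fun x => by
      have : a x ≤ r * v x := ha x
      show r⁻¹ * a x ≤ v x
      rwa [inv_mul_le_iff₀ (pos_iff_ne_zero.2 hr)]
    have h2 := hle _ _ h1
    have h3 : (r⁻¹ • a).toReal = (r : ℝ)⁻¹ • a.toReal := by
      ext x; simp [NNReal.smul_def]
    rw [h3, map_smul, smul_eq_mul, inv_mul_le_iff₀ (by positivity)] at h2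
    exact h2
  refine ⟨{ toFun := fun v => ⟨p v, hnonneg v⟩, map_add' := ?_, map_smul' := ?_ }, fun v =>
    hle v v le_rfl⟩
  · intro v w
    exact NNReal.eq (hadd v w)
  · intro r v
    refine NNReal.eq ?_
    show p (r • v) = r * p v
    rcases eq_or_ne r 0 with rfl | hr
    · have h := hadd 0 0
      rw [add_zero] at h
      simp only [zero_smul, NNReal.coe_zero, zero_mul]
      linarith
    · refine le_antisymm (hsm r v hr) ?_
      have h := hsm r⁻¹ (r • v) (inv_ne_zero hr)
      rw [smul_smul, inv_mul_cancel₀ hr, one_smul, NNReal.coe_inv,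
        le_inv_mul_iff₀ (by positivity)] at h
      exact h

variable [T2Space X] [LocallyCompactSpace X] [MeasurableSpace X] [BorelSpace X]

/-- Riesz representation of order-bounded linear functionals on `C_c(X, ℝ)` as a difference of
two Radon measures. -/
theorem exists_measure_sub_of_order_bounded (Λ : C_c(X, ℝ) →ₗ[ℝ] ℝ)
    (hb : ∀ v : C_c(X, ℝ≥0), BddAbove {r | ∃ w ≤ v, Λ w.toReal = r}) :
    ∃ μ ν : Measure X, IsFiniteMeasureOnCompacts μ ∧ IsFiniteMeasureOnCompacts ν ∧
      ∀ u, Λ u = (∫ x, u x ∂μ) - ∫ x, u x ∂ν := by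
  obtain ⟨P, hP⟩ := exists_nnreal_linear_ge Λ hb
  let N : C_c(X, ℝ≥0) →ₗ[ℝ≥0] ℝ≥0 :=
    { toFun := fun v => ⟨P v - Λ v.toReal, sub_nonneg.2 (hP v)⟩
      map_add' := fun v w => NNReal.eq (by
        show ((P (v + w) : ℝ≥0) : ℝ) - Λ (v + w).toReal
          = (P v - Λ v.toReal) + (P w - Λ w.toReal)
        rw [map_add, CompactlySupportedContinuousMap.toReal_add, map_add, NNReal.coe_add]
        ring)
      map_smul' := fun r v => NNReal.eq (by
        show ((P (r • v) : ℝ≥0) : ℝ) - Λ (r • v).toReal = r * (P v - Λ v.toReal)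
        have h3 : (r • v).toReal = (r : ℝ) • v.toReal := by ext x; simp [NNReal.smul_def]
        rw [map_smul, h3, map_smul, smul_eq_mul, smul_eq_mul, NNReal.coe_mul]
        ring) }
  have hPi := fun v => NNRealRMK.integral_rieszMeasure P v
  have hNi := fun v => NNRealRMK.integral_rieszMeasure N v
  have key : ∀ v : C_c(X, ℝ≥0), Λ v.toReal =
      (∫ x, (v x : ℝ) ∂(NNRealRMK.rieszMeasure P)) -
        ∫ x, (v x : ℝ) ∂(NNRealRMK.rieszMeasure N) := fun v => by
    rw [hPi, hNi]
    show _ = (P v : ℝ) - (P v - Λ v.toReal)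
    ring
  refine ⟨NNRealRMK.rieszMeasure P, NNRealRMK.rieszMeasure N, inferInstance, inferInstance,
    fun u => ?_⟩
  have hint : ∀ (μ : Measure X) [IsFiniteMeasureOnCompacts μ] (v : C_c(X, ℝ≥0)),
      Integrable (fun x => (v x : ℝ)) μ := fun μ _ v => by
    have := v.toReal.continuous.integrable_of_hasCompactSupport v.toReal.hasCompactSupport (μ := μ)
    exact this.congr (ae_of_all _ fun x => CompactlySupportedContinuousMap.toReal_apply v x)
  have hu : ∀ x, u x = (u.nnrealPart x : ℝ) - ((-u).nnrealPart x : ℝ) := fun x => by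
    conv_lhs => rw [← CompactlySupportedContinuousMap.nnrealPart_sub_nnrealPart_neg u]
    simp
  simp_rw [hu]
  rw [integral_sub (hint _ _) (hint _ _), integral_sub (hint _ _) (hint _ _)]
  conv_lhs => rw [← CompactlySupportedContinuousMap.nnrealPart_sub_nnrealPart_neg u]
  rw [map_sub, key, key]
  ring

end Riesz

/-! ### Signed Radon measures and the Jordan decomposition -/

/-- Jordan decomposition of a difference of two Radon measures. -/
theorem exists_signedRadon_of_sub {n : ℕ} (μ ν : Measure (Rn n)) [IsFiniteMeasureOnCompacts μ]
    [IsFiniteMeasureOnCompacts ν] :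
    ∃ D : SignedRadon n, ∀ u : Rn n → ℝ, Continuous u → HasCompactSupport u →
      D.integral u = (∫ x, u x ∂μ) - ∫ x, u x ∂ν := by
  set l := μ + ν with hl
  have hμl : μ ≪ l := Measure.AbsolutelyContinuous.mk fun s _ hs => by
    simp only [hl, Measure.add_apply, add_eq_zero] at hs; exact hs.1
  have hνl : ν ≪ l := Measure.AbsolutelyContinuous.mk fun s _ hs => by
    simp only [hl, Measure.add_apply, add_eq_zero] at hs; exact hs.2
  set a := μ.rnDeriv l with ha
  set b := ν.rnDeriv l with hb
  have ham : Measurable a := Measure.measurable_rnDeriv _ _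
  have hbm : Measurable b := Measure.measurable_rnDeriv _ _
  have hμ : l.withDensity a = μ := Measure.withDensity_rnDeriv_eq _ _ hμl
  have hν : l.withDensity b = ν := Measure.withDensity_rnDeriv_eq _ _ hνl
  -- Subtraction in `ℝ≥0∞` is truncated, so `a - b` and `b - a` are the positive and negative parts
  -- of the density of `μ - ν`.
  have hpos : l.withDensity (a - b) ≤ μ := by
    conv_rhs => rw [← hμ]
    exact withDensity_mono (ae_of_all _ fun x => tsub_le_self)
  have hneg : l.withDensity (b - a) ≤ ν := by
    conv_rhs => rw [← hν]
    exact withDensity_mono (ae_of_all _ fun x => tsub_le_self)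
  have fp : IsFiniteMeasureOnCompacts (l.withDensity (a - b)) :=
    ⟨fun K hK => (hpos K).trans_lt hK.measure_lt_top⟩
  have fn : IsFiniteMeasureOnCompacts (l.withDensity (b - a)) :=
    ⟨fun K hK => (hneg K).trans_lt hK.measure_lt_top⟩
  refine ⟨⟨l.withDensity (a - b), l.withDensity (b - a), fp, fn, ?_⟩, fun u hu hc => ?_⟩
  · refine ⟨{x | a x ≤ b x}, measurableSet_le ham hbm, ?_, ?_⟩
    · rw [withDensity_apply _ (measurableSet_le ham hbm),
        setLIntegral_eq_zero_iff (measurableSet_le ham hbm) (ham.sub hbm)]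
      exact ae_of_all _ fun x (hx : a x ≤ b x) => tsub_eq_zero_of_le hx
    · rw [withDensity_apply _ (measurableSet_le ham hbm).compl,
        setLIntegral_eq_zero_iff (measurableSet_le ham hbm).compl (hbm.sub ham)]
      exact ae_of_all _ fun x (hx : ¬ a x ≤ b x) => tsub_eq_zero_of_le (not_le.1 hx).le
  · have hi : ∀ (κ : Measure (Rn n)) [IsFiniteMeasureOnCompacts κ], Integrable u κ :=
      fun κ _ => hu.integrable_of_hasCompactSupport hc
    have hfa : ∀ᵐ x ∂l, a x < ⊤ := Measure.rnDeriv_lt_top _ _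
    have hfb : ∀ᵐ x ∂l, b x < ⊤ := Measure.rnDeriv_lt_top _ _
    have hfab : ∀ᵐ x ∂l, (a - b) x < ⊤ := hfa.mono fun x h => tsub_le_self.trans_lt h
    have hfba : ∀ᵐ x ∂l, (b - a) x < ⊤ := hfb.mono fun x h => tsub_le_self.trans_lt h
    have e : ∀ c : Rn n → ℝ≥0∞, Measurable c → (∀ᵐ x ∂l, c x < ⊤) →
        IsFiniteMeasureOnCompacts (l.withDensity c) →
        Integrable (fun x => (c x).toReal • u x) l ∧
        ∫ x, u x ∂(l.withDensity c) = ∫ x, (c x).toReal • u x ∂l := fun c hc h hf =>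
      ⟨(integrable_withDensity_iff_integrable_smul' hc h).1 (hi _),
        integral_withDensity_eq_integral_toReal_smul hc h _⟩
    obtain ⟨i1, e1⟩ := e _ (ham.sub hbm) hfab fp
    obtain ⟨i2, e2⟩ := e _ (hbm.sub ham) hfba fn
    obtain ⟨i3, e3⟩ := e _ ham hfa (by rw [hμ]; infer_instance)
    obtain ⟨i4, e4⟩ := e _ hbm hfb (by rw [hν]; infer_instance)
    rw [hμ] at e3
    rw [hν] at e4
    simp only [SignedRadon.integral]
    rw [e1, e2, e3, e4, ← integral_sub i1 i2, ← integral_sub i3 i4]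
    refine integral_congr_ae ?_
    filter_upwards [hfa, hfb] with x h1 h2
    simp only [Pi.sub_apply, smul_eq_mul]
    rcases le_total (a x) (b x) with h | h
    · rw [tsub_eq_zero_of_le h, ENNReal.toReal_sub_of_le h h2.ne]; simp; ring
    · rw [tsub_eq_zero_of_le h, ENNReal.toReal_sub_of_le h h1.ne]; simp; ring

/-- Uniqueness of the Jordan decomposition. -/
theorem SignedRadon.ext_of_add_eq {n : ℕ} {D E : SignedRadon n}
    (h : D.pos + E.neg = E.pos + D.neg) : D = E := by
  -- `a` is carried by a set on which `d` vanishes, and there `a ≤ a + c = b`.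
  have key : ∀ {a b c d : Measure (Rn n)}, a ⟂ₘ d → a + c = b + d → a ≤ b := by
    intro a b c d had he
    obtain ⟨s, hs, h1, h2⟩ := had
    refine Measure.le_iff.2 fun t ht => ?_
    calc a t ≤ a (t ∩ sᶜ) + a s := by
          refine (measure_mono (t := (t ∩ sᶜ) ∪ s) fun x hx => ?_).trans (measure_union_le _ _)
          by_cases hxs : x ∈ s <;> simp [hx, hxs]
      _ = a (t ∩ sᶜ) := by rw [h1, add_zero]
      _ ≤ (a + c) (t ∩ sᶜ) := by simp
      _ = b (t ∩ sᶜ) + d (t ∩ sᶜ) := by rw [he]; rfl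
      _ = b (t ∩ sᶜ) := by rw [measure_mono_null inter_subset_right h2, add_zero]
      _ ≤ b t := measure_mono inter_subset_left
  refine SignedRadon.ext (le_antisymm (key D.singular h) (key E.singular h.symm)) ?_
  refine le_antisymm (key D.singular.symm (c := E.pos) (d := D.pos) ?_)
    (key E.singular.symm (c := D.pos) ?_)
  · rw [add_comm, ← h, add_comm]
  · rw [add_comm, h, add_comm]

/-! ### Test functions and uniform approximation -/

theorem IsTest.add {n : ℕ} {F : Type*} [NormedAddCommGroup F] [NormedSpace ℝ F]
    {u v : Rn n → F} (hu : IsTest u) (hv : IsTest v) : IsTest (u + v) :=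
  ⟨hu.1.add hv.1, hu.2.add hv.2⟩

theorem IsTest.const_smul {n : ℕ} {F : Type*} [NormedAddCommGroup F] [NormedSpace ℝ F]
    {u : Rn n → F} (c : ℝ) (hu : IsTest u) : IsTest (c • u) :=
  ⟨contDiff_const.smul hu.1, hu.2.smul_left (f := fun _ => c)⟩

theorem IsTest.sub {n : ℕ} {F : Type*} [NormedAddCommGroup F] [NormedSpace ℝ F]
    {u v : Rn n → F} (hu : IsTest u) (hv : IsTest v) : IsTest (u - v) := by
  have := hu.add (hv.const_smul (-1))
  rwa [neg_one_smul, ← sub_eq_add_neg] at this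

/-- `w k` are test functions with supports in a common ball, converging uniformly to `u`. -/
structure TestApprox {n : ℕ} (u : Rn n → ℝ) (w : ℕ → Rn n → ℝ) : Prop where
  isTest : ∀ k, IsTest (w k)
  supp : ∃ R, ∀ k, tsupport (w k) ⊆ Metric.closedBall 0 R
  unif : ∀ ε > 0, ∀ᶠ k in atTop, ∀ x, |w k x - u x| ≤ ε

/-- Uniform continuity permits smoothing at a scale at most `1`, hence the radius `R + 1`. The
explicit radius and error bound make the estimate over an order interval uniform in
`exists_signedRadon`. -/
theorem exists_testApprox {n : ℕ} (u : C_c(Rn n, ℝ)) {R : ℝ}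
    (hR : tsupport u ⊆ Metric.closedBall 0 R) :
    ∃ w, TestApprox u w ∧ (∀ k, tsupport (w k) ⊆ Metric.closedBall 0 (R + 1)) ∧
      ∀ k x, |w k x - u x| ≤ 1 := by
  have hcont : Continuous (u : Rn n → ℝ) := u.continuous
  have huc : UniformContinuous u :=
    u.hasCompactSupport.uniformContinuous_of_continuous u.continuous
  have step : ∀ k : ℕ, ∃ g : Rn n → ℝ, IsTest g ∧ tsupport g ⊆ Metric.closedBall 0 (R + 1) ∧
      ∀ x, |g x - u x| ≤ 1 / ((k : ℝ) + 1) := by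
    intro k
    obtain ⟨δ, hδ, hd⟩ := Metric.uniformContinuous_iff.1 huc (1 / ((k : ℝ) + 1)) (by positivity)
    obtain ⟨g, hg, hga⟩ := hcont.exists_contDiff_dist_le_of_forall_mem_ball_dist_le
      (lt_min one_pos hδ)
    have hs : tsupport g ⊆ Metric.closedBall 0 (R + 1) := by
      refine closure_minimal (fun x hx => ?_) Metric.isClosed_closedBall
      by_contra hxR
      have hz : ∀ y ∈ Metric.ball x (min 1 δ), u y = 0 := fun y hy => by
        refine image_eq_zero_of_notMem_tsupport fun hy' => hxR ?_
        have h1 := hR hy'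
        rw [mem_closedBall_zero_iff] at h1 ⊢
        have h2 : dist y x < 1 := (lt_min_iff.1 hy).1
        rw [dist_comm, dist_eq_norm] at h2
        calc ‖x‖ = ‖y + (x - y)‖ := by congr 1; abel
          _ ≤ _ := norm_add_le _ _
          _ ≤ R + 1 := by linarith
      have hx0 : u x = 0 := hz x (Metric.mem_ball_self (lt_min one_pos hδ))
      have := hga x 0 (fun y hy => by rw [hz y hy, hx0, dist_self])
      rw [hx0, dist_zero_right, norm_le_zero_iff] at this
      exact hx this
    refine ⟨g, ⟨hg, HasCompactSupport.intro' (isCompact_closedBall _ _)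
      Metric.isClosed_closedBall fun x hx => image_eq_zero_of_notMem_tsupport fun h =>
        hx (hs h)⟩, hs, fun x => ?_⟩
    rw [← Real.dist_eq]
    exact hga x _ fun y hy => (hd ((lt_min_iff.1 hy).2)).le
  choose w hw hs hwu using step
  refine ⟨w, ⟨hw, ⟨_, hs⟩, fun ε hε => ?_⟩, hs, fun k x => (hwu k x).trans ?_⟩
  · have := tendsto_one_div_add_atTop_nhds_zero_nat (𝕜 := ℝ)
    filter_upwards [this.eventually (gt_mem_nhds hε)] with k hk x
    exact (hwu k x).trans hk.le
  · rw [div_le_one (by positivity)]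
    have : (0 : ℝ) ≤ k := by positivity
    linarith

theorem exists_tsupport_subset_closedBall {n : ℕ} {F : Type*} [NormedAddCommGroup F]
    {u : Rn n → F} (hu : HasCompactSupport u) :
    ∃ R, 0 < R ∧ tsupport u ⊆ Metric.closedBall 0 R := by
  obtain ⟨R, hR, h⟩ := hu.isCompact.isBounded.subset_closedBall_lt 0 0
  exact ⟨R, hR, h⟩

theorem TestApprox.add {n : ℕ} {u v : Rn n → ℝ} {w z : ℕ → Rn n → ℝ} (hw : TestApprox u w)
    (hz : TestApprox v z) : TestApprox (u + v) (fun k => w k + z k) := by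
  obtain ⟨R, hR⟩ := hw.supp
  obtain ⟨S, hS⟩ := hz.supp
  refine ⟨fun k => (hw.isTest k).add (hz.isTest k), ⟨max R S, fun k => ?_⟩, fun ε hε => ?_⟩
  · refine (tsupport_add _ _).trans (union_subset ((hR k).trans ?_) ((hS k).trans ?_))
    · exact Metric.closedBall_subset_closedBall (le_max_left _ _)
    · exact Metric.closedBall_subset_closedBall (le_max_right _ _)
  · filter_upwards [hw.unif (ε / 2) (half_pos hε), hz.unif (ε / 2) (half_pos hε)] with k h1 h2 x
    calc |(w k + z k) x - (u + v) x| = |(w k x - u x) + (z k x - v x)| := by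
          simp only [Pi.add_apply]; congr 1; ring
      _ ≤ _ := abs_add_le _ _
      _ ≤ ε := by linarith [h1 x, h2 x]

theorem TestApprox.const_smul {n : ℕ} {u : Rn n → ℝ} {w : ℕ → Rn n → ℝ} (c : ℝ)
    (hw : TestApprox u w) : TestApprox (c • u) (fun k => c • w k) := by
  obtain ⟨R, hR⟩ := hw.supp
  refine ⟨fun k => (hw.isTest k).const_smul c, ⟨R, fun k => ?_⟩, fun ε hε => ?_⟩
  · exact (closure_mono (Function.support_const_smul_subset c (w k))).trans (hR k)
  · filter_upwards [hw.unif (ε / (|c| + 1)) (by positivity)] with k h1 x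
    calc |(c • w k) x - (c • u) x| = |c| * |w k x - u x| := by
          simp only [Pi.smul_apply, smul_eq_mul]; rw [← mul_sub, abs_mul]
      _ ≤ (|c| + 1) * (ε / (|c| + 1)) := by
          gcongr
          · linarith
          · exact h1 x
      _ = ε := by field_simp

theorem TestApprox.const {n : ℕ} {u : Rn n → ℝ} (hu : IsTest u) : TestApprox u (fun _ => u) := by
  obtain ⟨R, -, hR⟩ := exists_tsupport_subset_closedBall hu.2
  exact ⟨fun _ => hu, ⟨R, fun _ => hR⟩, fun ε hε => Eventually.of_forall fun k x => by simp [hε.le]⟩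

/-! ### Locally bounded functionals on test functions -/

/-- A linear functional on test functions that is bounded for the uniform norm on each ball. -/
structure IsLocBddFunctional {n : ℕ} (T : (Rn n → ℝ) → ℝ) : Prop where
  add : ∀ u v, IsTest u → IsTest v → T (u + v) = T u + T v
  smul : ∀ (c : ℝ) u, IsTest u → T (c • u) = c * T u
  bdd : ∀ R, ∃ C, ∀ u, IsTest u → tsupport u ⊆ Metric.closedBall 0 R →
    ∀ M, (∀ x, |u x| ≤ M) → T u ≤ C * M

namespace IsLocBddFunctional

variable {n : ℕ} {T : (Rn n → ℝ) → ℝ}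

theorem abs_map_le (hT : IsLocBddFunctional T) (R : ℝ) : ∃ C, 0 ≤ C ∧ ∀ u, IsTest u →
    tsupport u ⊆ Metric.closedBall 0 R → ∀ M, (∀ x, |u x| ≤ M) → |T u| ≤ C * M := by
  obtain ⟨C, hC⟩ := hT.bdd R
  refine ⟨|C|, abs_nonneg _, fun u hu hs M hM => ?_⟩
  have hM0 : 0 ≤ M := (abs_nonneg _).trans (hM 0)
  have h1 := hC u hu hs M hM
  have h2 := hC ((-1 : ℝ) • u) (hu.const_smul _)
    ((closure_mono (Function.support_const_smul_subset _ u)).trans hs) M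
    (fun x => by simpa using hM x)
  rw [hT.smul _ _ hu] at h2
  have h3 : C * M ≤ |C| * M := mul_le_mul_of_nonneg_right (le_abs_self C) hM0
  rw [abs_le]
  constructor <;> linarith

theorem map_sub (hT : IsLocBddFunctional T) {u v : Rn n → ℝ} (hu : IsTest u) (hv : IsTest v) :
    T (u - v) = T u - T v := by
  have h : u - v = u + (-1 : ℝ) • v := by rw [neg_one_smul, sub_eq_add_neg]
  rw [h, hT.add _ _ hu (hv.const_smul _), hT.smul _ _ hv]
  ring

theorem tendsto_zero (hT : IsLocBddFunctional T) {w : ℕ → Rn n → ℝ} (hw : TestApprox 0 w) :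
    Tendsto (fun k => T (w k)) atTop (𝓝 0) := by
  obtain ⟨R, hR⟩ := hw.supp
  obtain ⟨C, hC0, hC⟩ := hT.abs_map_le R
  rw [Metric.tendsto_atTop']
  intro ε hε
  obtain ⟨N, hN⟩ := eventually_atTop.1 (hw.unif (ε / (C + 1)) (by positivity))
  refine ⟨N, fun k hk => ?_⟩
  have := hC (w k) (hw.isTest k) (hR k) (ε / (C + 1)) (fun x => by simpa using hN k hk.le x)
  rw [Real.dist_eq, sub_zero]
  refine this.trans_lt ?_
  rw [mul_div_assoc', div_lt_iff₀ (by positivity)]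
  nlinarith

theorem exists_tendsto (hT : IsLocBddFunctional T) {u : Rn n → ℝ} {w : ℕ → Rn n → ℝ}
    (hw : TestApprox u w) :
    ∃ L, Tendsto (fun k => T (w k)) atTop (𝓝 L) := by
  apply cauchySeq_tendsto_of_complete
  obtain ⟨R, hR⟩ := hw.supp
  obtain ⟨C, hC0, hC⟩ := hT.abs_map_le R
  rw [Metric.cauchySeq_iff']
  intro ε hε
  obtain ⟨N, hN⟩ := eventually_atTop.1 (hw.unif (ε / (2 * (C + 1))) (by positivity))
  refine ⟨N, fun k hk => ?_⟩
  have := hC (w k - w N) ((hw.isTest k).sub (hw.isTest N))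
    ((tsupport_sub _ _).trans (union_subset (hR k) (hR N))) (ε / (C + 1)) (fun x => by
      calc |(w k - w N) x| = |(w k x - u x) - (w N x - u x)| := by
            simp only [Pi.sub_apply]; congr 1; ring
        _ ≤ _ := abs_sub _ _
        _ ≤ ε / (2 * (C + 1)) + ε / (2 * (C + 1)) := add_le_add (hN k hk x) (hN N le_rfl x)
        _ = ε / (C + 1) := by field_simp; ring)
  rw [Real.dist_eq, ← hT.map_sub (hw.isTest k) (hw.isTest N)]
  refine this.trans_lt ?_
  rw [mul_div_assoc', div_lt_iff₀ (by positivity)]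
  nlinarith

/-- A locally bounded functional on test functions extends to `C_c`. -/
theorem exists_extension (hT : IsLocBddFunctional T) : ∃ L : C_c(Rn n, ℝ) →ₗ[ℝ] ℝ,
    ∀ (u : C_c(Rn n, ℝ)) w, TestApprox u w →
      Tendsto (fun k => T (w k)) atTop (𝓝 (L u)) := by
  have hex : ∀ u : C_c(Rn n, ℝ), ∃ l, ∀ w, TestApprox u w →
      Tendsto (fun k => T (w k)) atTop (𝓝 l) := by
    intro u
    obtain ⟨R, -, hR⟩ := exists_tsupport_subset_closedBall u.hasCompactSupport
    obtain ⟨z, hz, -, -⟩ := exists_testApprox u hR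
    obtain ⟨l, hl⟩ := hT.exists_tendsto hz
    refine ⟨l, fun w hw => ?_⟩
    -- Two approximations of `u` differ by an approximation of `0`, so the limit does not depend on
    -- the choice.
    have h0 := hw.add (hz.const_smul (-1))
    have h1 : (u : Rn n → ℝ) + (-1 : ℝ) • (u : Rn n → ℝ) = 0 := by simp
    rw [h1] at h0
    have h2 := (hT.tendsto_zero h0).add hl
    rw [zero_add] at h2
    refine h2.congr fun k => ?_
    rw [hT.add _ _ (hw.isTest k) ((hz.isTest k).const_smul _), hT.smul _ _ (hz.isTest k)]
    ring
  choose l hl using hex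
  have happ : ∀ u : C_c(Rn n, ℝ), ∃ w, TestApprox u w := fun u => by
    obtain ⟨R, -, hR⟩ := exists_tsupport_subset_closedBall u.hasCompactSupport
    obtain ⟨z, hz, -, -⟩ := exists_testApprox u hR
    exact ⟨z, hz⟩
  refine ⟨{ toFun := l, map_add' := fun u v => ?_, map_smul' := fun c u => ?_ }, hl⟩
  · obtain ⟨w, hw⟩ := happ u
    obtain ⟨z, hz⟩ := happ v
    refine tendsto_nhds_unique (hl (u + v) _ (hw.add hz)) (((hl u w hw).add (hl v z hz)).congr
      fun k => (hT.add _ _ (hw.isTest k) (hz.isTest k)).symm)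
  · obtain ⟨w, hw⟩ := happ u
    exact tendsto_nhds_unique (hl (c • u) _ (hw.const_smul c)) (((hl u w hw).const_mul c).congr
      fun k => (hT.smul _ _ (hw.isTest k)).symm)

/-- Riesz representation by a signed Radon measure. -/
theorem exists_signedRadon (hT : IsLocBddFunctional T) :
    ∃ D : SignedRadon n, ∀ u, IsTest u → T u = D.integral u := by
  obtain ⟨L, hL⟩ := hT.exists_extension
  obtain ⟨μ, ν, hμ, hν, h⟩ := exists_measure_sub_of_order_bounded L (fun v => by
    obtain ⟨R, -, hR⟩ := exists_tsupport_subset_closedBall v.toReal.hasCompactSupport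
    obtain ⟨C, hC0, hC⟩ := hT.abs_map_le (R + 1)
    obtain ⟨M, hM⟩ := v.toReal.hasCompactSupport.exists_bound_of_continuous v.toReal.continuous
    -- `M` bounds `v`, hence every `w ≤ v`; the approximants of `w` exceed this by at most `1` and
    -- live in the ball of radius `R + 1`.
    refine ⟨C * (M + 1), ?_⟩
    rintro _ ⟨w, hw, rfl⟩
    have hwv : ∀ x, (w x : ℝ) ≤ v x := fun x => NNReal.coe_le_coe.2 (hw x)
    have hws : tsupport w.toReal ⊆ Metric.closedBall 0 R := by
      refine (closure_mono fun x hx => ?_).trans hR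
      contrapose! hx
      have h1 : (v x : ℝ) = 0 := by simpa using hx
      have h2 : (w x : ℝ) = 0 := le_antisymm (h1 ▸ hwv x) (w x).2
      simpa using h2
    obtain ⟨z, hz, hzs, hz1⟩ := exists_testApprox w.toReal hws
    refine le_of_tendsto (hL _ z hz) (Eventually.of_forall fun k => ?_)
    refine (le_abs_self _).trans (hC _ (hz.isTest k) (hzs k) _ fun x => ?_)
    have h1 := hM x
    have h2 := hz1 k x
    have h3 := hwv x
    have h4 : (0 : ℝ) ≤ w x := (w x).2
    rw [CompactlySupportedContinuousMap.toReal_apply] at h1 h2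
    rw [Real.norm_eq_abs] at h1
    have h5 := le_abs_self (v x : ℝ)
    rw [abs_le] at h2 ⊢
    constructor <;> linarith)
  obtain ⟨D, hD⟩ := exists_signedRadon_of_sub μ ν
  refine ⟨D, fun u hu => ?_⟩
  rw [hD u hu.1.continuous hu.2]
  have h1 := h ⟨⟨u, hu.1.continuous⟩, hu.2⟩
  have h2 := hL ⟨⟨u, hu.1.continuous⟩, hu.2⟩ _ (TestApprox.const hu)
  exact (tendsto_nhds_unique tendsto_const_nhds h2).trans h1

end IsLocBddFunctional

/-! ### Test functions determine signed Radon measures -/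

theorem TestApprox.tendsto_integral {n : ℕ} {u : Rn n → ℝ} {w : ℕ → Rn n → ℝ}
    (hw : TestApprox u w) (μ : Measure (Rn n)) [IsFiniteMeasureOnCompacts μ] (hu : Continuous u) :
    Tendsto (fun k => ∫ x, w k x ∂μ) atTop (𝓝 (∫ x, u x ∂μ)) := by
  obtain ⟨R, hR⟩ := hw.supp
  have hlim : ∀ x, Tendsto (fun k => w k x) atTop (𝓝 (u x)) := fun x => by
    rw [Metric.tendsto_nhds]
    intro ε hε
    filter_upwards [hw.unif (ε / 2) (half_pos hε)] with k hk
    rw [Real.dist_eq]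
    linarith [hk x]
  have hz : ∀ k, ∀ x ∉ Metric.closedBall (0 : Rn n) R, w k x = 0 := fun k x hx =>
    image_eq_zero_of_notMem_tsupport fun h => hx (hR k h)
  have hu0 : ∀ x ∉ Metric.closedBall (0 : Rn n) R, u x = 0 := fun x hx =>
    tendsto_nhds_unique (hlim x) (by simp [hz _ x hx])
  have hset : ∀ v : Rn n → ℝ, (∀ x ∉ Metric.closedBall (0 : Rn n) R, v x = 0) →
      ∫ x, v x ∂μ = ∫ x in Metric.closedBall 0 R, v x ∂μ := fun v hv =>
    (setIntegral_eq_integral_of_forall_compl_eq_zero hv).symm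
  rw [hset u hu0]
  simp_rw [hset _ (hz _)]
  have : IsFiniteMeasure (μ.restrict (Metric.closedBall (0 : Rn n) R)) :=
    ⟨by rw [Measure.restrict_apply_univ]; exact (isCompact_closedBall _ _).measure_lt_top⟩
  refine tendsto_integral_filter_of_dominated_convergence (fun x => |u x| + 1)
    (Eventually.of_forall fun k => (hw.isTest k).1.continuous.aestronglyMeasurable) ?_ ?_
    (ae_of_all _ hlim)
  · filter_upwards [hw.unif 1 one_pos] with k hk
    refine ae_of_all _ fun x => ?_
    rw [Real.norm_eq_abs]
    linarith [hk x, abs_sub_abs_le_abs_sub (w k x) (u x)]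
  · have : ContinuousOn (fun x => |u x| + 1) (Metric.closedBall (0 : Rn n) R) := by fun_prop
    exact this.integrableOn_compact (isCompact_closedBall _ _)

/-- Signed Radon measures are determined by their integrals of test functions. -/
theorem SignedRadon.ext_of_integral_eq {n : ℕ} {D E : SignedRadon n}
    (h : ∀ u, IsTest u → D.integral u = E.integral u) : D = E := by
  have := D.finite_pos
  have := D.finite_neg
  have := E.finite_pos
  have := E.finite_neg
  -- With the negative parts moved across, both sides are positive Radon measures, which `C_c`
  -- functions separate.
  apply SignedRadon.ext_of_add_eq
  have hadd : ∀ (κ η : Measure (Rn n)) [IsFiniteMeasureOnCompacts κ]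
      [IsFiniteMeasureOnCompacts η], IsFiniteMeasureOnCompacts (κ + η) := fun κ η _ _ =>
    ⟨fun K hK => ENNReal.add_lt_top.2 ⟨hK.measure_lt_top, hK.measure_lt_top⟩⟩
  have := hadd D.pos E.neg
  have := hadd E.pos D.neg
  refine Measure.ext_of_integral_eq_on_compactlySupported fun u => ?_
  have hi : ∀ (κ : Measure (Rn n)) [IsFiniteMeasureOnCompacts κ], Integrable u κ :=
    fun κ _ => u.continuous.integrable_of_hasCompactSupport u.hasCompactSupport
  rw [integral_add_measure (hi _) (hi _), integral_add_measure (hi _) (hi _)]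
  obtain ⟨R, -, hR⟩ := exists_tsupport_subset_closedBall u.hasCompactSupport
  obtain ⟨w, hw, -, -⟩ := exists_testApprox u hR
  have t := fun (κ : Measure (Rn n)) [IsFiniteMeasureOnCompacts κ] =>
    hw.tendsto_integral κ u.continuous
  have h1 := tendsto_nhds_unique (((t D.pos).sub (t D.neg)).congr fun k => h (w k) (hw.isTest k))
    ((t E.pos).sub (t E.neg))
  linarith

/-! ### Integrability of the fractional kernel -/

/-- In polar coordinates the radial density is `r^{-α}` on `(0,1]`, integrable as `α < 1`, and
`r^{-1-α}` beyond, integrable as `α > 0`. -/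
theorem integrable_min_one_norm_div_rpow (n : ℕ) {α : ℝ} (hα0 : 0 < α) (hα1 : α < 1) :
    Integrable fun z : Rn n => min 1 ‖z‖ / ‖z‖ ^ ((n : ℝ) + α) := by
  rcases n with _ | m
  · have : (fun z : Rn 0 => min 1 ‖z‖ / ‖z‖ ^ (((0 : ℕ) : ℝ) + α)) = fun _ => 0 := by
      funext z
      rw [Subsingleton.elim z 0]; simp
    rw [this]
    exact integrable_zero _ _ _
  have : Nontrivial (Rn (m + 1)) := inferInstance
  refine (integrable_fun_norm_addHaar (volume : Measure (Rn (m + 1)))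
    (f := fun r : ℝ => min 1 r / r ^ (((m + 1 : ℕ) : ℝ) + α))).2 ?_
  have hd : Module.finrank ℝ (Rn (m + 1)) - 1 = m := by simp
  rw [hd]
  have hrw : ∀ r : ℝ, 0 < r → r ^ m • (min 1 r / r ^ (((m + 1 : ℕ) : ℝ) + α))
      = min 1 r * r ^ (-1 - α) := by
    intro r hr
    have h1 : r ^ (((m + 1 : ℕ) : ℝ) + α) = r ^ m * r ^ (1 + α) := by
      rw [← Real.rpow_natCast, ← Real.rpow_add hr]; congr 1; push_cast; ring
    have h2 : r ^ (-1 - α) = (r ^ (1 + α))⁻¹ := by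
      rw [← Real.rpow_neg hr.le]; congr 1; ring
    have h3 : r ^ (1 + α) ≠ 0 := (Real.rpow_pos_of_pos hr _).ne'
    rw [h1, h2, smul_eq_mul]
    field_simp
  rw [← Ioc_union_Ioi_eq_Ioi zero_le_one, integrableOn_union]
  constructor
  · have h : IntegrableOn (fun r : ℝ => r ^ (-α)) (Ioc 0 1) :=
      (intervalIntegral.intervalIntegrable_rpow' (by linarith)).1
    refine h.congr_fun (fun r hr => ?_) measurableSet_Ioc
    dsimp only
    rw [hrw r hr.1, min_eq_right hr.2]
    nth_rewrite 2 [← Real.rpow_one r]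
    rw [← Real.rpow_add hr.1]; congr 1; ring
  · have h : IntegrableOn (fun r : ℝ => r ^ (-1 - α)) (Ioi 1) :=
      integrableOn_Ioi_rpow_of_lt (by linarith) one_pos
    refine h.congr_fun (fun r (hr : 1 < r) => ?_) measurableSet_Ioi
    dsimp only
    rw [hrw r (zero_lt_one.trans hr), min_eq_left hr.le, one_mul]

/-- The integrand of the fractional divergence at `x`, as a function of the increment `z`. -/
noncomputable def fracKernel {n : ℕ} (α : ℝ) (φ : Rn n → Rn n) (x z : Rn n) : ℝ :=
  inner ℝ (φ (x + z) - φ x) z / ‖z‖ ^ ((n : ℝ) + α + 1)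

theorem fracDiv_eq {n : ℕ} (α : ℝ) (φ : Rn n → Rn n) (x : Rn n) :
    fracDiv α φ x = muConst n α * ∫ z, fracKernel α φ x z := by
  rw [fracDiv, ← integral_add_left_eq_self (μ := volume) _ x]
  simp [fracKernel]

theorem abs_fracKernel_le {n : ℕ} {α : ℝ} (φ : Rn n → Rn n) (x z : Rn n) :
    |fracKernel α φ x z| ≤ ‖φ (x + z) - φ x‖ / ‖z‖ ^ ((n : ℝ) + α) := by
  rcases eq_or_ne z 0 with rfl | hz
  · simp [fracKernel]
  have hz' : 0 < ‖z‖ := norm_pos_iff.2 hz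
  rw [fracKernel, abs_div, abs_of_pos (Real.rpow_pos_of_pos hz' _),
    Real.rpow_add_one hz'.ne', div_le_div_iff₀ (by positivity) (by positivity)]
  have := abs_real_inner_le_norm (φ (x + z) - φ x) z
  have h2 : 0 < ‖z‖ ^ ((n : ℝ) + α) := by positivity
  nlinarith

theorem IsTest.exists_norm_sub_le {n : ℕ} {F : Type*} [NormedAddCommGroup F] [NormedSpace ℝ F]
    {φ : Rn n → F} (hφ : IsTest φ) :
    ∃ C, 0 ≤ C ∧ ∀ x z, ‖φ (x + z) - φ x‖ ≤ C * min 1 ‖z‖ := by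
  obtain ⟨M, hM⟩ := hφ.2.exists_bound_of_continuous hφ.1.continuous
  obtain ⟨L, hL⟩ := hφ.1.lipschitzWith_of_hasCompactSupport hφ.2 (by simp)
  have hM0 : 0 ≤ M := (norm_nonneg _).trans (hM 0)
  refine ⟨max (2 * M) L, by positivity, fun x z => ?_⟩
  rcases le_total 1 ‖z‖ with h | h
  · rw [min_eq_left h, mul_one]
    refine le_trans ?_ (le_max_left _ _)
    linarith [norm_sub_le (φ (x + z)) (φ x), hM (x + z), hM x]
  · rw [min_eq_right h]
    have := hL.dist_le_mul (x + z) x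
    rw [dist_eq_norm, dist_eq_norm, add_sub_cancel_left] at this
    exact this.trans (mul_le_mul_of_nonneg_right (le_max_right _ _) (norm_nonneg _))

theorem measurable_fracKernel {n : ℕ} (α : ℝ) {φ : Rn n → Rn n} (hφ : IsTest φ) :
    Measurable (Function.uncurry (fracKernel α φ)) := by
  have := hφ.1.continuous.measurable
  unfold fracKernel Function.uncurry
  fun_prop

theorem integrable_fracKernel {n : ℕ} {α : ℝ} (hα0 : 0 < α) (hα1 : α < 1) {φ : Rn n → Rn n}
    (hφ : IsTest φ) (x : Rn n) : Integrable (fracKernel α φ x) := by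
  obtain ⟨C, hC0, hC⟩ := hφ.exists_norm_sub_le
  refine ((integrable_min_one_norm_div_rpow n hα0 hα1).const_mul C).mono'
    ((measurable_fracKernel α hφ).of_uncurry_left).aestronglyMeasurable (ae_of_all _ fun z => ?_)
  rw [Real.norm_eq_abs, mul_div_assoc']
  exact (abs_fracKernel_le φ x z).trans (by gcongr; exact hC x z)

/-- The kernel vanishes unless `x` or `x + z` lies in the support of `φ`. It is thus dominated by `b
x * w z + b (x + z) * w z`, whose second term is the first one composed with a measure-preserving
shear. -/
theorem integrable_uncurry_fracKernel {n : ℕ} {α : ℝ} (hα0 : 0 < α) (hα1 : α < 1)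
    {φ : Rn n → Rn n} (hφ : IsTest φ) :
    Integrable (Function.uncurry (fracKernel α φ)) (volume.prod volume) := by
  obtain ⟨C, hC0, hC⟩ := hφ.exists_norm_sub_le
  set w : Rn n → ℝ := fun z => min 1 ‖z‖ / ‖z‖ ^ ((n : ℝ) + α) with hw
  have hwi : Integrable w := integrable_min_one_norm_div_rpow n hα0 hα1
  set b : Rn n → ℝ := (tsupport φ).indicator fun _ => C with hb
  have hbi : Integrable b := by
    rw [hb, integrable_indicator_iff (isClosed_tsupport φ).measurableSet]
    exact integrableOn_const hφ.2.isCompact.measure_lt_top.ne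
  have h1 : Integrable (fun p : Rn n × Rn n => b p.1 * w p.2) (volume.prod volume) :=
    hbi.mul_prod hwi
  have h2 : Integrable (fun p : Rn n × Rn n => b (p.1 + p.2) * w p.2) (volume.prod volume) := by
    have hmp := measurePreserving_add_prod (volume : Measure (Rn n)) (volume : Measure (Rn n))
    exact hmp.integrable_comp_of_integrable h1
  refine (h1.add h2).mono' (measurable_fracKernel α hφ).aestronglyMeasurable
    (ae_of_all _ fun p => ?_)
  obtain ⟨x, z⟩ := p
  show |fracKernel α φ x z| ≤ b x * w z + b (x + z) * w z
  have hw0 : 0 ≤ w z := by positivity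
  have hb0 : ∀ y, 0 ≤ b y := fun y => indicator_nonneg (fun _ _ => hC0) y
  refine (abs_fracKernel_le φ x z).trans ?_
  by_cases hx : x ∈ tsupport φ
  · have : b x = C := indicator_of_mem hx _
    have h3 : ‖φ (x + z) - φ x‖ / ‖z‖ ^ ((n : ℝ) + α) ≤ C * w z := by
      rw [hw, mul_div_assoc']; gcongr; exact hC x z
    rw [this]
    nlinarith [mul_nonneg (hb0 (x + z)) hw0]
  by_cases hxz : x + z ∈ tsupport φ
  · have : b (x + z) = C := indicator_of_mem hxz _
    have h3 : ‖φ (x + z) - φ x‖ / ‖z‖ ^ ((n : ℝ) + α) ≤ C * w z := by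
      rw [hw, mul_div_assoc']; gcongr; exact hC x z
    rw [this]
    nlinarith [mul_nonneg (hb0 x) hw0]
  · rw [image_eq_zero_of_notMem_tsupport hx, image_eq_zero_of_notMem_tsupport hxz]
    simp only [sub_self, norm_zero, zero_div]
    have := mul_nonneg (hb0 x) hw0
    have := mul_nonneg (hb0 (x + z)) hw0
    linarith

theorem integrable_fracDiv {n : ℕ} {α : ℝ} (hα0 : 0 < α) (hα1 : α < 1)
    {φ : Rn n → Rn n} (hφ : IsTest φ) : Integrable (fracDiv α φ) := by
  have h := (integrable_uncurry_fracKernel hα0 hα1 hφ).integral_prod_left.const_mul (muConst n α)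
  exact h.congr (ae_of_all _ fun x => (fracDiv_eq α φ x).symm)

theorem integrable_mul_fracDiv {n : ℕ} {α : ℝ} (hα0 : 0 < α) (hα1 : α < 1) {f : Rn n → ℝ}
    (hf : MemLp f ⊤ volume) {φ : Rn n → Rn n} (hφ : IsTest φ) :
    Integrable fun x => f x * fracDiv α φ x :=
  (integrable_fracDiv hα0 hα1 hφ).mul_of_top_right hf

theorem fracDiv_add {n : ℕ} {α : ℝ} (hα0 : 0 < α) (hα1 : α < 1) {φ ψ : Rn n → Rn n}
    (hφ : IsTest φ) (hψ : IsTest ψ) (x : Rn n) :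
    fracDiv α (φ + ψ) x = fracDiv α φ x + fracDiv α ψ x := by
  rw [fracDiv_eq, fracDiv_eq, fracDiv_eq, ← mul_add,
    ← integral_add (integrable_fracKernel hα0 hα1 hφ x) (integrable_fracKernel hα0 hα1 hψ x)]
  congr 2
  funext z
  simp only [fracKernel, Pi.add_apply]
  rw [← add_div, ← inner_add_left]
  congr 2; abel

theorem fracDiv_smul {n : ℕ} (α c : ℝ) (φ : Rn n → Rn n) (x : Rn n) :
    fracDiv α (c • φ) x = c * fracDiv α φ x := by
  rw [fracDiv_eq, fracDiv_eq, mul_left_comm]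
  congr 1
  rw [← integral_const_mul]
  congr 1
  funext z
  simp only [fracKernel, Pi.smul_apply]
  rw [← smul_sub, real_inner_smul_left, mul_div_assoc]

/-! ### One-dimensional integrals and the renormalization constants -/

theorem integrable_sq_add_rpow {q r : ℝ} (hq : 1 < q) (hr : 0 < r) :
    Integrable fun s : ℝ => (s ^ 2 + r) ^ (-q / 2) := by
  have h := integrable_rpow_neg_one_add_norm_sq (E := ℝ) (μ := volume) (r := q) (by simpa using hq)
  set c := min 1 r with hc
  have hc0 : 0 < c := lt_min one_pos hr
  refine (h.const_mul (c ^ (-q / 2))).mono' ?_ (ae_of_all _ fun s => ?_)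
  · exact Measurable.aestronglyMeasurable (by fun_prop)
  · have h1 : 0 < s ^ 2 + r := by positivity
    rw [Real.norm_eq_abs, abs_of_nonneg (by positivity), Real.norm_eq_abs, sq_abs,
      ← Real.mul_rpow hc0.le (by positivity)]
    refine Real.rpow_le_rpow_of_nonpos (by positivity) ?_ (by linarith)
    have : c ≤ 1 := min_le_left _ _
    have : c ≤ r := min_le_right _ _
    nlinarith [sq_nonneg s]

/-- `∫ (s² + r)^{-p/2} ds = √π Γ((p-1)/2) / Γ(p/2) r^{-(p-1)/2}`. -/
theorem integral_sq_add_rpow {p r : ℝ} (hp : 1 < p) (hr : 0 < r) :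
    ∫ s : ℝ, (s ^ 2 + r) ^ (-p / 2) =
      √Real.pi * Real.Gamma ((p - 1) / 2) / Real.Gamma (p / 2) * r ^ (-(p - 1) / 2) := by
  have hG : 0 < Real.Gamma (p / 2) := Real.Gamma_pos_of_pos (by linarith)
  -- Integrating `F` in `u` gives `Γ(p/2)` times the integrand; integrating first in `s` leaves a
  -- Gaussian, then another Gamma integral.
  set F : ℝ → ℝ → ℝ := fun s u => u ^ (p / 2 - 1) * Real.exp (-((s ^ 2 + r) * u)) with hF
  have hin : ∀ s, ∫ u in Ioi 0, F s u = (s ^ 2 + r) ^ (-p / 2) * Real.Gamma (p / 2) := by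
    intro s
    have h1 : 0 < s ^ 2 + r := by positivity
    rw [hF, Real.integral_rpow_mul_exp_neg_mul_Ioi (by linarith) h1, one_div,
      Real.inv_rpow h1.le, ← Real.rpow_neg h1.le, neg_div]
  have hout : ∀ u ∈ Ioi (0 : ℝ), ∫ s, F s u =
      √Real.pi * (u ^ ((p - 1) / 2 - 1) * Real.exp (-(r * u))) := by
    intro u (hu : 0 < u)
    have h1 : ∀ s, F s u = u ^ (p / 2 - 1) * Real.exp (-(r * u)) * Real.exp (-u * s ^ 2) := by
      intro s
      rw [hF]; dsimp only
      rw [mul_assoc, ← Real.exp_add]; congr 2; ring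
    simp_rw [h1]
    rw [integral_const_mul, integral_gaussian, Real.sqrt_div Real.pi_pos.le]
    have h2 : u ^ (p / 2 - 1) = u ^ ((p - 1) / 2 - 1) * √u := by
      rw [Real.sqrt_eq_rpow, ← Real.rpow_add hu]; congr 1; ring
    have : √u ≠ 0 := (Real.sqrt_pos.2 hu).ne'
    rw [h2]; field_simp
  have hmeas : Measurable (Function.uncurry F) := by
    unfold Function.uncurry; simp only [hF]; fun_prop
  have hint : Integrable (Function.uncurry F) (volume.prod (volume.restrict (Ioi 0))) := by
    rw [integrable_prod_iff hmeas.aestronglyMeasurable]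
    constructor
    · refine ae_of_all _ fun s => ?_
      refine Integrable.of_integral_ne_zero ?_
      show ∫ u in Ioi 0, F s u ≠ 0
      rw [hin]
      have h1 : 0 < s ^ 2 + r := by positivity
      positivity
    · have : ∀ s, ∫ u in Ioi 0, ‖Function.uncurry F (s, u)‖ =
          (s ^ 2 + r) ^ (-p / 2) * Real.Gamma (p / 2) := fun s => by
        rw [← hin]
        refine setIntegral_congr_fun measurableSet_Ioi fun u (hu : 0 < u) => ?_
        show ‖F s u‖ = F s u
        rw [Real.norm_eq_abs, abs_of_nonneg (by positivity)]
      simp_rw [this]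
      exact (integrable_sq_add_rpow hp hr).mul_const _
  have hsw := integral_integral_swap hint
  simp_rw [hin] at hsw
  rw [integral_mul_const, setIntegral_congr_fun measurableSet_Ioi hout, integral_const_mul,
    Real.integral_rpow_mul_exp_neg_mul_Ioi (by linarith) hr, one_div, Real.inv_rpow hr.le,
    ← Real.rpow_neg hr.le] at hsw
  rw [eq_div_of_mul_eq hG.ne' hsw, neg_div]
  ring

theorem integrable_mul_sq_add_rpow {p r : ℝ} (hp : 2 < p) (hr : 0 < r) :
    Integrable fun s : ℝ => s * (s ^ 2 + r) ^ (-p / 2) := by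
  refine (integrable_sq_add_rpow (q := p - 1) (by linarith) hr).mono'
    (Measurable.aestronglyMeasurable (by fun_prop)) (ae_of_all _ fun s => ?_)
  have h1 : 0 < s ^ 2 + r := by positivity
  rw [norm_mul, Real.norm_eq_abs, Real.norm_eq_abs, abs_of_nonneg (a := _ ^ _) (by positivity)]
  have h2 : |s| ≤ (s ^ 2 + r) ^ (1 / 2 : ℝ) := by
    rw [← Real.sqrt_eq_rpow]
    exact Real.abs_le_sqrt (by linarith)
  calc |s| * (s ^ 2 + r) ^ (-p / 2) ≤ (s ^ 2 + r) ^ (1 / 2 : ℝ) * (s ^ 2 + r) ^ (-p / 2) := by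
        gcongr
    _ = _ := by rw [← Real.rpow_add h1]; congr 1; ring

/-- The integrand is odd. -/
theorem integral_mul_sq_add_rpow (p r : ℝ) : ∫ s : ℝ, s * (s ^ 2 + r) ^ (-p / 2) = 0 := by
  have h := integral_neg_eq_self (fun s : ℝ => s * (s ^ 2 + r) ^ (-p / 2)) volume
  simp only [neg_sq, neg_mul, integral_neg] at h
  linarith

/-- The relation between the renormalization constants in consecutive dimensions. -/
theorem muConst_succ_mul (m : ℕ) {α : ℝ} (hα0 : 0 < α) :
    muConst (m + 1) α * (√Real.pi * Real.Gamma (((m : ℝ) + α + 1) / 2) /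
      Real.Gamma (((m : ℝ) + α + 2) / 2)) = muConst m α := by
  have hG : Real.Gamma (((m : ℝ) + α + 2) / 2) ≠ 0 :=
    (Real.Gamma_pos_of_pos (by positivity)).ne'
  have h1 : Real.pi ^ (-((m + 1 : ℕ) : ℝ) / 2) * √Real.pi = Real.pi ^ (-(m : ℝ) / 2) := by
    rw [Real.sqrt_eq_rpow, ← Real.rpow_add Real.pi_pos]; congr 1; push_cast; ring
  have h2 : ((m + 1 : ℕ) : ℝ) + α + 1 = (m : ℝ) + α + 2 := by push_cast; ring
  rw [muConst, muConst, ← h1, h2]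
  field_simp

/-! ### The splitting of `ℝ^{m+1}` into `ℝ × ℝᵐ` -/

/-- The identification `ℝ × ℝᵐ ≃ ℝ^{m+1}` as a continuous linear equivalence. -/
noncomputable def consCLE (m : ℕ) : (ℝ × Rn m) ≃L[ℝ] Rn (m + 1) where
  toFun := consHomeo m
  invFun := (consHomeo m).symm
  left_inv := (consHomeo m).left_inv
  right_inv := (consHomeo m).right_inv
  map_add' p q := by
    ext i
    refine Fin.cases ?_ (fun j => ?_) i <;> simp [consHomeo]
  map_smul' c p := by
    ext i
    refine Fin.cases ?_ (fun j => ?_) i <;> simp [consHomeo]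
  continuous_toFun := (consHomeo m).continuous
  continuous_invFun := (consHomeo m).symm.continuous

/-- The last `m` coordinates of a point of `ℝ^{m+1}`. -/
noncomputable def tailL (m : ℕ) : Rn (m + 1) →L[ℝ] Rn m :=
  (ContinuousLinearMap.snd ℝ ℝ (Rn m)).comp (consCLE m).symm.toContinuousLinearMap

theorem tailL_apply {m : ℕ} (v : Rn (m + 1)) (i : Fin m) : tailL m v i = v i.succ := rfl

theorem tailL_consHomeo {m : ℕ} (p : ℝ × Rn m) : tailL m (consHomeo m p) = p.2 := by
  ext i
  simp [tailL_apply, consHomeo]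

theorem consHomeo_add {m : ℕ} (p q : ℝ × Rn m) :
    consHomeo m p + consHomeo m q = consHomeo m (p + q) := ((consCLE m).map_add p q).symm

theorem inner_consHomeo {m : ℕ} (v : Rn (m + 1)) (p : ℝ × Rn m) :
    inner ℝ v (consHomeo m p) = v 0 * p.1 + inner ℝ (tailL m v) p.2 := by
  simp only [PiLp.inner_apply, Fin.sum_univ_succ, tailL_apply]
  simp [consHomeo, mul_comm]

theorem norm_consHomeo_sq {m : ℕ} (p : ℝ × Rn m) :
    ‖consHomeo m p‖ ^ 2 = p.1 ^ 2 + ‖p.2‖ ^ 2 := by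
  rw [← real_inner_self_eq_norm_sq, inner_consHomeo, tailL_consHomeo, real_inner_self_eq_norm_sq]
  simp [consHomeo, sq]

theorem norm_snd_le_norm_consHomeo {m : ℕ} (p : ℝ × Rn m) : ‖p.2‖ ≤ ‖consHomeo m p‖ :=
  (sq_le_sq₀ (norm_nonneg _) (norm_nonneg _)).1
    (by rw [norm_consHomeo_sq]; nlinarith [sq_nonneg p.1])

theorem abs_fst_le_norm_consHomeo {m : ℕ} (p : ℝ × Rn m) : |p.1| ≤ ‖consHomeo m p‖ :=
  (sq_le_sq₀ (abs_nonneg _) (norm_nonneg _)).1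
    (by rw [norm_consHomeo_sq, sq_abs]; nlinarith [sq_nonneg ‖p.2‖])

theorem measurePreserving_consHomeo (m : ℕ) :
    MeasurePreserving (consHomeo m) ((volume : Measure ℝ).prod (volume : Measure (Rn m)))
      volume := by
  have h1 := (volume_preserving_piFinSuccAbove (fun _ : Fin (m + 1) => ℝ) 0).symm
  have h2 : MeasurePreserving (Prod.map id WithLp.ofLp : ℝ × Rn m → ℝ × (Fin m → ℝ))
      ((volume : Measure ℝ).prod volume) ((volume : Measure ℝ).prod volume) :=
    (MeasurePreserving.id _).prod (PiLp.volume_preserving_ofLp (Fin m))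
  have h3 := (PiLp.volume_preserving_toLp (Fin (m + 1))).comp (h1.comp h2)
  have hfun : ⇑(consHomeo m) = WithLp.toLp 2 ∘
      ⇑(MeasurableEquiv.piFinSuccAbove (fun _ : Fin (m + 1) => ℝ) 0).symm ∘
      Prod.map id WithLp.ofLp := by
    funext p
    ext i
    refine Fin.cases ?_ (fun j => ?_) i <;> simp [consHomeo, MeasurableEquiv.piFinSuccAbove]
  rw [hfun]
  exact h3

theorem integral_comp_consHomeo {m : ℕ} {F : Type*} [NormedAddCommGroup F] [NormedSpace ℝ F]
    (u : Rn (m + 1) → F) :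
    ∫ p, u (consHomeo m p) ∂((volume : Measure ℝ).prod (volume : Measure (Rn m))) = ∫ x, u x :=
  (measurePreserving_consHomeo m).integral_comp (consHomeo m).measurableEmbedding u

/-! ### Fibre integration and the fractional divergence -/

/-- Integrating a test function over the first variable. -/
noncomputable def fiberIntegral {m : ℕ} {F : Type*} [NormedAddCommGroup F] [NormedSpace ℝ F]
    (φ : Rn (m + 1) → F) (x : Rn m) : F := ∫ t, φ (consHomeo m (t, x))

theorem IsTest.fiberIntegral {m : ℕ} {F : Type*} [NormedAddCommGroup F] [NormedSpace ℝ F]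
    [CompleteSpace F] {φ : Rn (m + 1) → F} (hφ : IsTest φ) : IsTest (fiberIntegral φ) := by
  obtain ⟨R, hR0, hR⟩ := exists_tsupport_subset_closedBall hφ.2
  have hz : ∀ p : ℝ × Rn m, R < |p.1| ∨ R < ‖p.2‖ → φ (consHomeo m p) = 0 := by
    intro p hp
    refine image_eq_zero_of_notMem_tsupport fun h => ?_
    have h1 := hR h
    rw [mem_closedBall_zero_iff] at h1
    rcases hp with hp | hp
    · linarith [abs_fst_le_norm_consHomeo p]
    · linarith [norm_snd_le_norm_consHomeo p]
  constructor
  -- The fibre integral is the value at `0` of the convolution in `t` of the constant `1` with `t ↦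
  -- φ(-t,x)`, so smoothness in the parameter `x` applies.
  · have h := contDiffOn_convolution_right_with_param (𝕜 := ℝ) (μ := (volume : Measure ℝ))
      (f := fun _ : ℝ => (1 : ℝ)) (n := ⊤)
      (ContinuousLinearMap.lsmul ℝ ℝ : ℝ →L[ℝ] F →L[ℝ] F)
      (g := fun (x : Rn m) (t : ℝ) => φ (consHomeo m (-t, x))) (s := univ)
      (k := Icc (-R) R) isOpen_univ isCompact_Icc
      (fun x t _ ht => hz _ (Or.inl (by
        rw [mem_Icc, ← abs_le, not_le] at ht
        simpa using ht)))
      (locallyIntegrable_const _)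
      (by
        have : ContDiff ℝ ∞ fun q : Rn m × ℝ => φ (consCLE m (-q.2, q.1)) :=
          hφ.1.comp ((consCLE m).contDiff.comp (contDiff_snd.neg.prodMk contDiff_fst))
        exact this.contDiffOn)
    rw [univ_prod_univ, contDiffOn_univ] at h
    have h2 := h.comp (contDiff_id.prodMk (contDiff_const (c := (0 : ℝ))) :
      ContDiff ℝ ∞ fun x : Rn m => (x, (0 : ℝ)))
    convert h2 using 1
    funext x
    simp [convolution, FracBV.fiberIntegral]
  · refine HasCompactSupport.intro (isCompact_closedBall 0 R) fun x hx => ?_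
    rw [mem_closedBall_zero_iff, not_le] at hx
    have : ∀ t, φ (consHomeo m (t, x)) = 0 := fun t => hz _ (Or.inr hx)
    simp [FracBV.fiberIntegral, this]

theorem IsTest.continuousLinearMap_comp {n : ℕ} {F G : Type*} [NormedAddCommGroup F]
    [NormedSpace ℝ F] [NormedAddCommGroup G] [NormedSpace ℝ G] {φ : Rn n → F} (hφ : IsTest φ)
    (L : F →L[ℝ] G) : IsTest fun x => L (φ x) :=
  ⟨L.contDiff.comp hφ.1, hφ.2.comp_left (g := L) (map_zero L)⟩

theorem IsTest.integrable_fiber {m : ℕ} {F : Type*} [NormedAddCommGroup F] [NormedSpace ℝ F]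
    {φ : Rn (m + 1) → F} (hφ : IsTest φ) (x : Rn m) :
    Integrable fun t : ℝ => φ (consHomeo m (t, x)) := by
  obtain ⟨R, hR0, hR⟩ := exists_tsupport_subset_closedBall hφ.2
  have hc : Continuous fun t : ℝ => φ (consHomeo m (t, x)) :=
    hφ.1.continuous.comp ((consHomeo m).continuous.comp (by fun_prop))
  refine hc.integrable_of_hasCompactSupport
    (HasCompactSupport.intro (isCompact_Icc (a := -R) (b := R)) fun t ht => ?_)
  refine image_eq_zero_of_notMem_tsupport fun h => ?_
  have h1 := hR h
  rw [mem_closedBall_zero_iff] at h1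
  rw [mem_Icc, ← abs_le, not_le] at ht
  linarith [abs_fst_le_norm_consHomeo ((t, x) : ℝ × Rn m)]

theorem integral_inner_consHomeo_div {m : ℕ} {α : ℝ} (hα0 : 0 < α) (v : Rn (m + 1)) {y : Rn m}
    (hy : y ≠ 0) :
    ∫ s : ℝ, inner ℝ v (consHomeo m (s, y)) / ‖consHomeo m (s, y)‖ ^ (((m + 1 : ℕ) : ℝ) + α + 1) =
      √Real.pi * Real.Gamma (((m : ℝ) + α + 1) / 2) / Real.Gamma (((m : ℝ) + α + 2) / 2) *
        (inner ℝ (tailL m v) y / ‖y‖ ^ ((m : ℝ) + α + 1)) := by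
  have hm : (1 : ℝ) ≤ m := by
    rcases m with _ | m
    · exact absurd (Subsingleton.elim y 0) hy
    · push_cast; linarith [(Nat.cast_nonneg m : (0 : ℝ) ≤ m)]
  have hy0 : 0 < ‖y‖ := norm_pos_iff.2 hy
  have hr : 0 < ‖y‖ ^ 2 := by positivity
  set p : ℝ := (m : ℝ) + α + 2 with hp
  have hn : ∀ s : ℝ, inner ℝ v (consHomeo m (s, y)) /
      ‖consHomeo m (s, y)‖ ^ (((m + 1 : ℕ) : ℝ) + α + 1) =
      v 0 * (s * (s ^ 2 + ‖y‖ ^ 2) ^ (-p / 2)) +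
        inner ℝ (tailL m v) y * (s ^ 2 + ‖y‖ ^ 2) ^ (-p / 2) := by
    intro s
    have h1 : 0 < s ^ 2 + ‖y‖ ^ 2 := by positivity
    have h2 : ‖consHomeo m (s, y)‖ = (s ^ 2 + ‖y‖ ^ 2) ^ (1 / 2 : ℝ) := by
      rw [← Real.sqrt_eq_rpow, ← Real.sqrt_sq (norm_nonneg (consHomeo m (s, y))),
        norm_consHomeo_sq]
    rw [h2, ← Real.rpow_mul h1.le, inner_consHomeo, div_eq_mul_inv, ← Real.rpow_neg h1.le]
    have h3 : -(1 / 2 * (((m + 1 : ℕ) : ℝ) + α + 1)) = -p / 2 := by rw [hp]; push_cast; ring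
    rw [h3]; ring
  simp_rw [hn]
  rw [integral_add ((integrable_mul_sq_add_rpow (by linarith) hr).const_mul _)
    ((integrable_sq_add_rpow (by linarith) hr).const_mul _), integral_const_mul,
    integral_const_mul, integral_mul_sq_add_rpow, integral_sq_add_rpow (by linarith) hr]
  have h4 : (‖y‖ ^ 2) ^ (-(p - 1) / 2) = (‖y‖ ^ ((m : ℝ) + α + 1))⁻¹ := by
    rw [← Real.rpow_natCast, ← Real.rpow_mul hy0.le, ← Real.rpow_neg hy0.le]
    congr 1; rw [hp]; push_cast; ring
  have h5 : p - 1 = (m : ℝ) + α + 1 := by rw [hp]; ring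
  rw [h4, h5]
  ring

/-- For almost every `x`, the integral of `div^α Φ` over the line above `x` is the fractional
divergence of the integrated field. -/
theorem integral_fracDiv_fiber {m : ℕ} {α : ℝ} (hα0 : 0 < α) (hα1 : α < 1)
    {Φ : Rn (m + 1) → Rn (m + 1)} (hΦ : IsTest Φ) :
    ∀ᵐ x : Rn m, ∫ t, fracDiv α Φ (consHomeo m (t, x)) =
      fracDiv α (fun x => tailL m (fiberIntegral Φ x)) x := by
  have hmp : MeasurePreserving
      (fun q : Rn m × ℝ × Rn (m + 1) => (consHomeo m (q.2.1, q.1), q.2.2))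
      ((volume : Measure (Rn m)).prod ((volume : Measure ℝ).prod (volume : Measure (Rn (m + 1)))))
      (volume.prod volume) := by
    have h1 := (measurePreserving_prodAssoc (volume : Measure (Rn m)) (volume : Measure ℝ)
      (volume : Measure (Rn (m + 1)))).symm
    have h2 := ((measurePreserving_consHomeo m).comp
      (Measure.measurePreserving_swap (μ := (volume : Measure (Rn m)))
        (ν := (volume : Measure ℝ)))).prod (MeasurePreserving.id (volume : Measure (Rn (m + 1))))
    exact h2.comp h1
  have hint := hmp.integrable_comp_of_integrable (integrable_uncurry_fracKernel hα0 hα1 hΦ)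
  -- Only here is "almost every `x`" used: Fubini gives integrability in `(t,z)` for almost every
  -- slice.
  filter_upwards [hint.prod_right_ae] with x hx
  have hx' : Integrable (Function.uncurry fun (t : ℝ) z => fracKernel α Φ (consHomeo m (t, x)) z)
      (volume.prod volume) := hx
  simp_rw [fracDiv_eq]
  rw [integral_const_mul, integral_integral_swap hx']
  set V : Rn m → Rn (m + 1) := fun y => fiberIntegral Φ (x + y) - fiberIntegral Φ x with hV
  have hG : ∀ p : ℝ × Rn m, ∫ t : ℝ, fracKernel α Φ (consHomeo m (t, x)) (consHomeo m p) =
      inner ℝ (V p.2) (consHomeo m p) / ‖consHomeo m p‖ ^ (((m + 1 : ℕ) : ℝ) + α + 1) := by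
    rintro ⟨s, y⟩
    simp only [fracKernel, consHomeo_add, Prod.mk_add_mk]
    -- Translating `t` by `s` does not change the integral, so the averaged increment depends on `y`
    -- alone.
    have i1 : Integrable fun t : ℝ => Φ (consHomeo m (t + s, x + y)) :=
      (hΦ.integrable_fiber (x + y)).comp_add_right s
    have e1 : ∫ t : ℝ, Φ (consHomeo m (t + s, x + y)) = fiberIntegral Φ (x + y) :=
      integral_add_right_eq_self (fun t => Φ (consHomeo m (t, x + y))) s
    rw [integral_div]
    congr 1
    simp_rw [real_inner_comm (consHomeo m (s, y))]
    have e2 := integral_inner (𝕜 := ℝ) (i1.sub (hΦ.integrable_fiber x)) (consHomeo m (s, y))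
    simp only [Pi.sub_apply] at e2
    rw [e2, integral_sub i1 (hΦ.integrable_fiber x), e1]
    rfl
  have hGi : Integrable (fun p : ℝ × Rn m =>
      ∫ t : ℝ, fracKernel α Φ (consHomeo m (t, x)) (consHomeo m p))
      ((volume : Measure ℝ).prod volume) :=
    (measurePreserving_consHomeo m).integrable_comp_of_integrable hx'.integral_prod_right
  rw [← integral_comp_consHomeo, integral_prod_symm _ hGi, ← muConst_succ_mul m hα0, mul_assoc]
  congr 1
  rw [← integral_const_mul]
  congr 1
  funext y
  simp_rw [hG]
  rcases eq_or_ne y 0 with rfl | hy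
  · simp [hV, fracKernel]
  · rw [integral_inner_consHomeo_div hα0 _ hy, fracKernel, ← map_sub]

/-- The fractional divergence of a test field tested against a function that does not depend on
the first variable. -/
theorem integral_mul_fracDiv_eq {m : ℕ} {α : ℝ} (hα0 : 0 < α) (hα1 : α < 1)
    {f : Rn (m + 1) → ℝ} (hf : MemLp f ⊤ volume) {g : Rn m → ℝ}
    (hfg : ∀ᵐ p : ℝ × Rn m, f (consHomeo m p) = g p.2)
    {Φ : Rn (m + 1) → Rn (m + 1)} (hΦ : IsTest Φ) :
    ∫ y, f y * fracDiv α Φ y =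
      ∫ x, g x * fracDiv α (fun x => tailL m (fiberIntegral Φ x)) x := by
  have hi := (measurePreserving_consHomeo m).integrable_comp_of_integrable
    (integrable_mul_fracDiv hα0 hα1 hf hΦ)
  have hae : (fun p => f (consHomeo m p) * fracDiv α Φ (consHomeo m p))
      =ᵐ[(volume : Measure ℝ).prod (volume : Measure (Rn m))]
      fun p => g p.2 * fracDiv α Φ (consHomeo m p) := hfg.mono fun p hp => by simp only [hp]
  rw [← integral_comp_consHomeo, integral_congr_ae hae, integral_prod_symm _ (hi.congr hae)]
  refine integral_congr_ae ?_
  filter_upwards [integral_fracDiv_fiber hα0 hα1 hΦ] with x hx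
  rw [← hx, ← integral_const_mul]

/-! ### Functions with vanishing first derivative -/

theorem exists_ae_norm_le_of_memLp_top {X E : Type*} [MeasurableSpace X] {μ : Measure X}
    [NormedAddCommGroup E] {f : X → E} (hf : MemLp f ⊤ μ) :
    ∃ C : ℝ, ∀ᵐ x ∂μ, ‖f x‖ ≤ C := by
  refine ⟨(eLpNorm f ⊤ μ).toReal, ?_⟩
  have h : ∀ᵐ x ∂μ, ‖f x‖ₑ ≤ eLpNorm f ⊤ μ := by
    rw [eLpNorm_exponent_top]; exact ae_le_eLpNormEssSup
  filter_upwards [h] with x hx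
  have := (ENNReal.toReal_le_toReal enorm_ne_top hf.2.ne).2 hx
  simpa using this

theorem IsTest.comp_sub_const {n : ℕ} {F : Type*} [NormedAddCommGroup F] [NormedSpace ℝ F]
    {φ : Rn n → F} (hφ : IsTest φ) (v : Rn n) : IsTest fun y => φ (y - v) :=
  ⟨hφ.1.comp (contDiff_id.sub contDiff_const),
    hφ.2.comp_homeomorph (Homeomorph.subRight v)⟩

/-- A bounded function whose `i`-th distributional derivative vanishes is, as a distribution,
invariant under translations in the `i`-th direction. -/
theorem WeakPartialZero.integral_translate {n : ℕ} {i : Fin n} {f : Rn n → ℝ}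
    (hf : MemLp f ⊤ volume) (hD : WeakPartialZero i f) {φ : Rn n → ℝ} (hφ : IsTest φ) (h : ℝ) :
    ∫ y, f y * φ (y - h • EuclideanSpace.single i 1) = ∫ y, f y * φ y := by
  set e : Rn n := EuclideanSpace.single i 1 with he
  have he1 : ‖e‖ = 1 := by simp [he]
  obtain ⟨R, hR0, hR⟩ := exists_tsupport_subset_closedBall hφ.2
  have hdc : Continuous (fderiv ℝ φ) := hφ.1.continuous_fderiv (by simp)
  obtain ⟨M, hM⟩ := (hφ.2.fderiv (𝕜 := ℝ)).exists_bound_of_continuous hdc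
  have hM0 : 0 ≤ M := (norm_nonneg _).trans (hM 0)
  have hint : ∀ s : ℝ, Integrable fun y => f y * φ (y - s • e) := fun s =>
    ((hφ.comp_sub_const (s • e)).1.continuous.integrable_of_hasCompactSupport
      (hφ.comp_sub_const (s • e)).2).mul_of_top_right hf
  have hd : ∀ s₀ : ℝ, HasDerivAt (fun s => ∫ y, f y * φ (y - s • e)) 0 s₀ := by
    intro s₀
    -- This ball contains the supports of all translates of `φ` with `|s - s₀| < 1`, so `B`
    -- dominates their derivatives.
    set B : Rn n → ℝ := (Metric.closedBall 0 (R + |s₀| + 1)).indicator fun _ => M with hB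
    have hBi : Integrable B := by
      rw [hB, integrable_indicator_iff measurableSet_closedBall]
      exact integrableOn_const (isCompact_closedBall _ _).measure_lt_top.ne
    have hdiff : ∀ (y : Rn n) (s : ℝ), HasDerivAt (fun s : ℝ => f y * φ (y - s • e))
        (f y * -(fderiv ℝ φ (y - s • e) e)) s := by
      intro y s
      have h1 : HasDerivAt (fun s : ℝ => y - s • e) (-e) s := by
        simpa using ((hasDerivAt_id s).smul_const e).const_sub y
      have h2 := ((hφ.1.differentiable (by simp)) (y - s • e)).hasFDerivAt.comp_hasDerivAt s h1
      rw [map_neg] at h2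
      exact h2.const_mul _
    have hcont : Continuous fun y => fderiv ℝ φ (y - s₀ • e) e :=
      (hdc.comp (continuous_id.sub continuous_const)).clm_apply continuous_const
    have key := hasDerivAt_integral_of_dominated_loc_of_deriv_le (μ := volume)
      (F := fun (s : ℝ) y => f y * φ (y - s • e))
      (F' := fun (s : ℝ) y => f y * -(fderiv ℝ φ (y - s • e) e)) (x₀ := s₀)
      (s := Metric.ball s₀ 1) (bound := fun y => |f y| * B y) (Metric.ball_mem_nhds _ one_pos)
      (Eventually.of_forall fun s => (hint s).aestronglyMeasurable) (hint s₀)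
      (hf.1.mul hcont.neg.aestronglyMeasurable)
      (ae_of_all _ fun y s hs => ?_)
      (hBi.mul_of_top_right hf.abs)
      (ae_of_all _ fun y s hs => hdiff y s)
    · have h0 : ∫ y, f y * -(fderiv ℝ φ (y - s₀ • e) e) = 0 := by
        have h1 := hD _ (hφ.comp_sub_const (s₀ • e))
        have h2 : ∀ y, fderiv ℝ (fun y => φ (y - s₀ • e)) y = fderiv ℝ φ (y - s₀ • e) :=
          fun y => fderiv_comp_sub (s₀ • e)
        simp_rw [h2] at h1
        simp_rw [mul_neg]
        rw [integral_neg, h1, neg_zero]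
      rw [← h0]
      exact key.2
    · rw [norm_mul, norm_neg, Real.norm_eq_abs]
      refine mul_le_mul_of_nonneg_left ?_ (abs_nonneg _)
      by_cases hy : y ∈ Metric.closedBall (0 : Rn n) (R + |s₀| + 1)
      · rw [hB, indicator_of_mem hy]
        exact ((fderiv ℝ φ (y - s • e)).le_opNorm e).trans (by rw [he1, mul_one]; exact hM _)
      · rw [hB, indicator_of_notMem hy]
        have : y - s • e ∉ tsupport φ := fun hys => by
          apply hy
          have h1 := hR hys
          rw [mem_closedBall_zero_iff] at h1 ⊢
          have h2 : |s| ≤ |s₀| + 1 := by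
            have : |s - s₀| < 1 := hs
            have := abs_sub_abs_le_abs_sub s s₀
            linarith
          calc ‖y‖ = ‖(y - s • e) + s • e‖ := by rw [sub_add_cancel]
            _ ≤ ‖y - s • e‖ + ‖s • e‖ := norm_add_le _ _
            _ ≤ R + |s₀| + 1 := by rw [norm_smul, he1, mul_one, Real.norm_eq_abs]; linarith
        have h3 : fderiv ℝ φ (y - s • e) = 0 := by
          by_contra hne
          exact this (support_fderiv_subset ℝ hne)
        simp [h3]
  have hconst := is_const_of_deriv_eq_zero (fun s => (hd s).differentiableAt)
    (fun s => (hd s).deriv) h 0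
  simpa using hconst

theorem WeakPartialZero.ae_translate {n : ℕ} {i : Fin n} {f : Rn n → ℝ}
    (hf : MemLp f ⊤ volume) (hD : WeakPartialZero i f) (h : ℝ) :
    ∀ᵐ y, f (y + h • EuclideanSpace.single i 1) = f y := by
  set e : Rn n := EuclideanSpace.single i 1 with he
  have hf' : MemLp (fun y => f (y + h • e)) ⊤ volume :=
    hf.comp_measurePreserving (measurePreserving_add_right volume (h • e))
  refine ae_eq_of_integral_contDiff_smul_eq (hf'.locallyIntegrable le_top)
    (hf.locallyIntegrable le_top) fun u hu hc => ?_
  have h1 := hD.integral_translate hf (φ := u) ⟨hu, hc⟩ h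
  have h2 := integral_add_right_eq_self (μ := volume)
    (fun y => f y * u (y - h • e)) (h • e)
  simp only [add_sub_cancel_right] at h2
  simp only [smul_eq_mul, mul_comm (u _)]
  rw [h2, h1]

/-- A bounded function on `ℝ^{m+1}` with `D_0 f = 0` depends only on the last `m` variables. -/
theorem WeakPartialZero.exists_eq_snd {m : ℕ} {f : Rn (m + 1) → ℝ}
    (hf : MemLp f ⊤ volume) (hD : WeakPartialZero 0 f) :
    ∃ g : Rn m → ℝ, MemLp g ⊤ volume ∧ ∀ᵐ p : ℝ × Rn m, f (consHomeo m p) = g p.2 := by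
  obtain ⟨F, hFm, hfF⟩ : ∃ F : ℝ × Rn m → ℝ, StronglyMeasurable F ∧
      ∀ᵐ p : ℝ × Rn m, f (consHomeo m p) = F p :=
    hf.1.comp_measurePreserving (measurePreserving_consHomeo m)
  have htr : ∀ h : ℝ, ∀ᵐ p : ℝ × Rn m, F (p.1 + h, p.2) = F p := by
    intro h
    have h1 := (measurePreserving_consHomeo m).quasiMeasurePreserving.ae (hD.ae_translate hf h)
    have h2 : MeasurePreserving (fun p : ℝ × Rn m => (p.1 + h, p.2))
        ((volume : Measure ℝ).prod volume) ((volume : Measure ℝ).prod volume) :=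
      (measurePreserving_add_right volume h).prod (MeasurePreserving.id _)
    filter_upwards [h1, hfF, h2.quasiMeasurePreserving.ae hfF] with p a b c
    rw [← b, ← c, ← a]
    congr 1
    ext j
    refine Fin.cases ?_ (fun j => ?_) j <;> simp [consHomeo]
  have hall : ∀ᵐ q : ℝ × ℝ × Rn m, F (q.2.1 + q.1, q.2.2) = F q.2 := by
    refine (Measure.ae_prod_iff_ae_ae ?_).2 (ae_of_all _ htr)
    have := hFm.measurable
    exact measurableSet_eq_fun (by fun_prop) (by fun_prop)
  -- Substituting the shift `t - r` and the base point `r` turns invariance under almost every shift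
  -- into `F(t,x) = F(r,x)` for almost every `(r,t,x)`.
  have hmp : MeasurePreserving (fun q : ℝ × ℝ × Rn m => (-q.1 + q.2.1, q.1, q.2.2))
      (volume : Measure (ℝ × ℝ × Rn m)) volume := by
    have a := measurePreserving_prodAssoc (volume : Measure ℝ) (volume : Measure ℝ)
      (volume : Measure (Rn m))
    have b := ((Measure.measurePreserving_swap (μ := (volume : Measure ℝ))
      (ν := (volume : Measure ℝ))).comp (measurePreserving_prod_neg_add (volume : Measure ℝ)
        (volume : Measure ℝ))).prod (MeasurePreserving.id (volume : Measure (Rn m)))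
    exact a.comp (b.comp a.symm)
  have hall2 : ∀ᵐ q : ℝ × ℝ × Rn m, F q.2 = F (q.1, q.2.2) := by
    filter_upwards [hmp.quasiMeasurePreserving.ae hall] with q hq
    rw [← hq]
    simp
  obtain ⟨C, hC⟩ := exists_ae_norm_le_of_memLp_top hf
  have hCF : ∀ᵐ p : ℝ × Rn m, ‖F p‖ ≤ C := by
    filter_upwards [(measurePreserving_consHomeo m).quasiMeasurePreserving.ae hC, hfF] with p a b
    rwa [← b]
  -- A generic `t` at which the slice is bounded and agrees with almost all of `F`.
  obtain ⟨t, ht1, ht2⟩ :=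
    ((Measure.ae_ae_of_ae_prod hall2).and (Measure.ae_ae_of_ae_prod hCF)).exists
  refine ⟨fun x => F (t, x), ?_, ?_⟩
  · exact memLp_top_of_bound (hFm.comp_measurable measurable_prodMk_left).aestronglyMeasurable C ht2
  · filter_upwards [hfF, ht1] with p a b
    rw [a, b]

/-! ### Existence of fractional variation measures -/

theorem IsTest.smul_const {n : ℕ} {F : Type*} [NormedAddCommGroup F] [NormedSpace ℝ F]
    {u : Rn n → ℝ} (hu : IsTest u) (v : F) : IsTest fun x => u x • v :=
  ⟨hu.1.smul contDiff_const, hu.2.smul_right⟩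

theorem isTest_zero {n : ℕ} {F : Type*} [NormedAddCommGroup F] [NormedSpace ℝ F] :
    IsTest (0 : Rn n → F) := ⟨contDiff_const, HasCompactSupport.zero⟩

section Pairing

variable {n : ℕ} {α : ℝ} {f : Rn n → ℝ}

theorem integral_mul_fracDiv_add (hα0 : 0 < α) (hα1 : α < 1) (hf : MemLp f ⊤ volume)
    {φ ψ : Rn n → Rn n} (hφ : IsTest φ) (hψ : IsTest ψ) :
    ∫ x, f x * fracDiv α (φ + ψ) x =
      (∫ x, f x * fracDiv α φ x) + ∫ x, f x * fracDiv α ψ x := by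
  rw [← integral_add (integrable_mul_fracDiv hα0 hα1 hf hφ)
    (integrable_mul_fracDiv hα0 hα1 hf hψ)]
  simp_rw [fracDiv_add hα0 hα1 hφ hψ, mul_add]

theorem integral_mul_fracDiv_smul (c : ℝ) (φ : Rn n → Rn n) :
    ∫ x, f x * fracDiv α (c • φ) x = c * ∫ x, f x * fracDiv α φ x := by
  simp_rw [fracDiv_smul, mul_left_comm _ c]
  rw [integral_const_mul]

theorem integral_mul_fracDiv_sum (hα0 : 0 < α) (hα1 : α < 1) (hf : MemLp f ⊤ volume)
    {ι : Type*} (s : Finset ι) {φ : ι → Rn n → Rn n} (hφ : ∀ i, IsTest (φ i)) :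
    IsTest (∑ i ∈ s, φ i) ∧ ∫ x, f x * fracDiv α (∑ i ∈ s, φ i) x =
      ∑ i ∈ s, ∫ x, f x * fracDiv α (φ i) x := by
  classical
  induction s using Finset.induction_on with
  | empty =>
    refine ⟨isTest_zero, ?_⟩
    simpa using integral_mul_fracDiv_smul (f := f) (α := α) 0 0
  | insert a s ha ih =>
    rw [Finset.sum_insert ha, Finset.sum_insert ha,
      integral_mul_fracDiv_add hα0 hα1 hf (hφ a) ih.1, ih.2]
    exact ⟨(hφ a).add ih.1, rfl⟩

theorem isLocBddFunctional_component (hα0 : 0 < α) (hα1 : α < 1) (hf : IsBVLoc α f) (i : Fin n) :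
    IsLocBddFunctional fun u : Rn n → ℝ =>
      -∫ x, f x * fracDiv α (fun x => u x • EuclideanSpace.single i 1) x := by
  have hsm : ∀ (c : ℝ) (u : Rn n → ℝ),
      (fun x => (c • u) x • (EuclideanSpace.single i 1 : Rn n)) =
        c • fun x => u x • (EuclideanSpace.single i 1 : Rn n) := fun c u => by
    funext x; simp only [Pi.smul_apply, smul_assoc]
  refine ⟨fun u v hu hv => ?_, fun c u hu => ?_, fun R => ?_⟩
  · have : (fun x => (u + v) x • (EuclideanSpace.single i 1 : Rn n)) =
        (fun x => u x • (EuclideanSpace.single i 1 : Rn n)) +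
          fun x => v x • (EuclideanSpace.single i 1 : Rn n) := by
      funext x; simp only [Pi.add_apply, add_smul]
    rw [this, integral_mul_fracDiv_add hα0 hα1 hf.1 (hu.smul_const _) (hv.smul_const _)]
    ring
  · rw [hsm, integral_mul_fracDiv_smul]
    ring
  · obtain ⟨C, hC⟩ := hf.2 (Metric.ball 0 (R + 1)) Metric.isOpen_ball
      (Metric.isBounded_ball.isCompact_closure)
    refine ⟨C, fun u hu hs M hM => ?_⟩
    have hM0 : 0 ≤ M := (abs_nonneg _).trans (hM 0)
    rcases hM0.eq_or_lt with rfl | hMpos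
    · have h0 : u = (0 : ℝ) • u := by
        funext x
        simpa using hM x
      rw [h0, hsm, integral_mul_fracDiv_smul]
      simp
    -- Dividing by `M` makes the field admissible; the sign matches that of the functional.
    · have hmem := hC ⟨(-M⁻¹) • fun x => u x • (EuclideanSpace.single i 1 : Rn n),
        (hu.smul_const _).const_smul _, fun x => ?_, ?_, rfl⟩
      · rw [integral_mul_fracDiv_smul] at hmem
        have : M⁻¹ * -(∫ x, f x * fracDiv α (fun x => u x • EuclideanSpace.single i 1) x) ≤ C := by
          linarith
        rwa [inv_mul_le_iff₀ hMpos, mul_comm] at this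
      · simp only [Pi.smul_apply, norm_smul, norm_neg, norm_inv, Real.norm_eq_abs,
          abs_of_pos hMpos, PiLp.norm_single, abs_one, mul_one]
        rw [inv_mul_le_iff₀ hMpos, mul_one]
        exact hM x
      · refine (closure_mono fun x hx => ?_ : _ ⊆ tsupport u).trans (hs.trans
          (Metric.closedBall_subset_ball (by linarith)))
        contrapose! hx
        simp only [Function.mem_support, not_not] at hx
        simp [hx]

theorem IsBVLoc.exists_isFracVariation (hα0 : 0 < α) (hα1 : α < 1) (hf : IsBVLoc α f) :
    ∃ D, IsFracVariation α f D := by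
  choose D hD using fun i => (isLocBddFunctional_component hα0 hα1 hf i).exists_signedRadon
  refine ⟨D, fun φ hφ => ?_⟩
  have hc : ∀ i, IsTest fun x => φ x i := fun i =>
    hφ.continuousLinearMap_comp (EuclideanSpace.proj i : Rn n →L[ℝ] ℝ)
  have hsum : φ = ∑ i, fun x => φ x i • (EuclideanSpace.single i 1 : Rn n) := by
    funext x
    ext j
    simp [Finset.sum_apply, Pi.single_apply]
  conv_lhs => rw [hsum]
  rw [(integral_mul_fracDiv_sum hα0 hα1 hf.1 _ fun i => (hc i).smul_const _).2,
    ← Finset.sum_neg_distrib]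
  refine Finset.sum_congr rfl fun i _ => ?_
  rw [← hD i _ (hc i), neg_neg]

end Pairing

/-! ### The splitting of the variation -/

/-- If `f(t,x) = g(x)` and `f` has locally finite fractional variation, then so does `g`. -/
theorem IsBVLoc.of_eq_snd {m : ℕ} {α : ℝ} (hα0 : 0 < α) (hα1 : α < 1) {f : Rn (m + 1) → ℝ}
    (hf : IsBVLoc α f) {g : Rn m → ℝ} (hg : MemLp g ⊤ volume)
    (hfg : ∀ᵐ p : ℝ × Rn m, f (consHomeo m p) = g p.2) : IsBVLoc α g := by
  refine ⟨hg, fun A _ hA => ?_⟩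
  obtain ⟨R, hR0, hR⟩ := hA.isBounded.subset_closedBall_lt 0 0
  let η : ContDiffBump (0 : ℝ) := ⟨1, 2, one_pos, one_lt_two⟩
  have hc : 0 < ∫ t, η t := η.integral_pos
  obtain ⟨C, hC⟩ := hf.2 (Metric.ball 0 (R + 3)) Metric.isOpen_ball
    (Metric.isBounded_ball.isCompact_closure)
  refine ⟨(∫ t, η t)⁻¹ * C, ?_⟩
  rintro _ ⟨φ, hφ, hφ1, hφA, rfl⟩
  -- This lift satisfies `‖Φ‖ ≤ 1`, and the tail of its fibre integral is `(∫ η) φ`. As `|t| ≤ 2`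
  -- and `‖x‖ ≤ R` on its support, it fits in the ball of radius `R + 3`.
  set Φ : Rn (m + 1) → Rn (m + 1) := fun y => η (y 0) • consCLE m (0, φ (tailL m y)) with hΦ
  have hsupp : tsupport Φ ⊆ Metric.closedBall 0 (R + 2) := by
    refine closure_minimal (fun y hy => ?_) Metric.isClosed_closedBall
    rw [Function.mem_support, hΦ, smul_ne_zero_iff] at hy
    obtain ⟨p, rfl⟩ := (consHomeo m).surjective y
    rw [tailL_consHomeo] at hy
    have h1 : |p.1| ≤ 2 := by
      have : η p.1 ≠ 0 := hy.1
      rw [← Function.mem_support, η.support_eq, mem_ball_zero_iff] at this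
      exact this.le
    have h2 : ‖p.2‖ ≤ R := by
      have : φ p.2 ≠ 0 := fun h => hy.2 (by rw [h]; exact (consCLE m).map_zero)
      exact mem_closedBall_zero_iff.1 (hR (subset_closure (hφA (subset_tsupport _ this))))
    rw [mem_closedBall_zero_iff]
    refine (sq_le_sq₀ (norm_nonneg _) (by linarith)).1 ?_
    rw [norm_consHomeo_sq, ← sq_abs p.1]
    nlinarith [abs_nonneg p.1, norm_nonneg p.2]
  have hΦt : IsTest Φ := by
    constructor
    · refine ContDiff.smul (η.contDiff.comp (EuclideanSpace.proj (𝕜 := ℝ) (0 : Fin (m + 1))).contDiff)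
        ((consCLE m).contDiff.comp (contDiff_const.prodMk (hφ.1.comp (tailL m).contDiff)))
    · exact HasCompactSupport.intro' (isCompact_closedBall _ _) Metric.isClosed_closedBall
        fun x hx => image_eq_zero_of_notMem_tsupport fun h => hx (hsupp h)
  have hΦ1 : ∀ y, ‖Φ y‖ ≤ 1 := fun y => by
    have h1 : ‖consCLE m (0, φ (tailL m y))‖ = ‖φ (tailL m y)‖ := by
      rw [← sq_eq_sq₀ (norm_nonneg _) (norm_nonneg _)]
      refine (norm_consHomeo_sq (m := m) (0, φ (tailL m y))).trans ?_
      simp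
    rw [hΦ, norm_smul, h1, Real.norm_eq_abs, abs_of_nonneg η.nonneg]
    exact mul_le_one₀ η.le_one (norm_nonneg _) (hφ1 _)
  have hψ : (fun x => tailL m (fiberIntegral Φ x)) = (∫ t, η t) • φ := by
    funext x
    have h1 : ∀ t : ℝ, Φ (consHomeo m (t, x)) = η t • consCLE m (0, φ x) := fun t => by
      rw [hΦ]; dsimp only; rw [tailL_consHomeo]; rfl
    simp only [fiberIntegral, h1]
    rw [integral_smul_const, map_smul]
    congr 1
  have h := hC ⟨Φ, hΦt, hΦ1, hsupp.trans (Metric.closedBall_subset_ball (by linarith)), rfl⟩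
  rw [integral_mul_fracDiv_eq hα0 hα1 hf.1 hfg hΦt, hψ, integral_mul_fracDiv_smul] at h
  rwa [le_inv_mul_iff₀ hc]

theorem SignedRadon.integral_zero {n : ℕ} (D : SignedRadon n) : D.integral (fun _ => 0) = 0 := by
  simp [SignedRadon.integral]

theorem IsFracVariation.integral_component {n : ℕ} {α : ℝ} {f : Rn n → ℝ}
    {D : Fin n → SignedRadon n} (hD : IsFracVariation α f D) {u : Rn n → ℝ} (hu : IsTest u)
    (i : Fin n) :
    ∫ x, f x * fracDiv α (fun x => u x • EuclideanSpace.single i 1) x = -(D i).integral u := by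
  rw [hD _ (hu.smul_const _), Finset.sum_eq_single i]
  · simp
  · intro j _ hj
    simp [hj, SignedRadon.integral_zero]
  · simp

theorem SignedRadon.integral_lebProd {m : ℕ} (ν : SignedRadon m) {u : Rn (m + 1) → ℝ}
    (hu : IsTest u) : ν.lebProd.integral u = ν.integral (fiberIntegral u) := by
  have key : ∀ (κ : Measure (Rn m)) [IsFiniteMeasureOnCompacts κ],
      ∫ y, u y ∂(FracBV.lebProd κ) = ∫ x, fiberIntegral u x ∂κ := by
    intro κ _
    rw [FracBV.lebProd, (consHomeo m).measurableEmbedding.integral_map, integral_prod_symm]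
    · rfl
    · exact (hu.1.continuous.comp (consHomeo m).continuous).integrable_of_hasCompactSupport
        (hu.2.comp_homeomorph (consHomeo m))
  have := ν.finite_pos
  have := ν.finite_neg
  simp only [SignedRadon.integral, SignedRadon.lebProd, key]

/-- The fractional variation of `f(t,x) = g(x)` in the directions of the last `m` variables. -/
theorem IsFracVariation.succ_eq_lebProd {m : ℕ} {α : ℝ} (hα0 : 0 < α) (hα1 : α < 1)
    {f : Rn (m + 1) → ℝ} (hf : MemLp f ⊤ volume) {g : Rn m → ℝ}
    (hfg : ∀ᵐ p : ℝ × Rn m, f (consHomeo m p) = g p.2)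
    {Df : Fin (m + 1) → SignedRadon (m + 1)} {Dg : Fin m → SignedRadon m}
    (hDf : IsFracVariation α f Df) (hDg : IsFracVariation α g Dg) (i : Fin m) :
    Df i.succ = (Dg i).lebProd := by
  refine SignedRadon.ext_of_integral_eq fun u hu => ?_
  have hψ : (fun x => tailL m (FracBV.fiberIntegral
      (fun y => u y • (EuclideanSpace.single i.succ 1 : Rn (m + 1))) x)) =
      fun x => FracBV.fiberIntegral u x • (EuclideanSpace.single i 1 : Rn m) := by
    funext x
    simp only [FracBV.fiberIntegral]
    rw [integral_smul_const, map_smul]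
    congr 1
    ext j
    simp [tailL_apply]
  have h := integral_mul_fracDiv_eq hα0 hα1 hf hfg
    (hu.smul_const (EuclideanSpace.single i.succ 1 : Rn (m + 1)))
  rw [hψ, hDf.integral_component hu, hDg.integral_component hu.fiberIntegral] at h
  rw [SignedRadon.integral_lebProd _ hu]
  linarith

end FracBV

theorem proposition1p9 (m : ℕ) (α : ℝ) (hα0 : 0 < α) (hα1 : α < 1)
    (f : FracBV.Rn (m + 1) → ℝ) (hf : FracBV.IsBVLoc α f)
    (hD : FracBV.WeakPartialZero 0 f) :
    ∃ g : FracBV.Rn m → ℝ, FracBV.IsBVLoc α g ∧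
      (∀ᵐ p : ℝ × FracBV.Rn m, f (FracBV.consHomeo m p) = g p.2) ∧
      (∃ Df, FracBV.IsFracVariation α f Df) ∧
      (∃ Dg, FracBV.IsFracVariation α g Dg) ∧
      ∀ Df Dg, FracBV.IsFracVariation α f Df → FracBV.IsFracVariation α g Dg →
        ∀ i : Fin m, Df i.succ = (Dg i).lebProd := by
  obtain ⟨g, hg, hfg⟩ := hD.exists_eq_snd hf.1
  have hgBV := hf.of_eq_snd hα0 hα1 hg hfg
  exact ⟨g, hgBV, hfg, hf.exists_isFracVariation hα0 hα1, hgBV.exists_isFracVariation hα0 hα1,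
    fun Df Dg hDf hDg i => hDf.succ_eq_lebProd hα0 hα1 hf.1 hfg hDg i⟩
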